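/- Let $R$ be a finite union of closed faces of the plane divided either into unit squares (the quadriculated case) or into unit equilateral triangles (the triangulated case), and suppose that $R$, as a subset of the plane, is simply connected (hence nonempty and path connected). Colour the faces of the plane black and white so that faces with a common side have different colours, and suppose that $R$ contains as many black faces as white faces, $n$ of each. Let $\Lambda$ be the graph whose vertices are the $2n$ faces of $R$, two of them being joined by an edge iff they have a common side. Label the faces, black ones first, so that the adjacency matrix of $\Lambda$ is $$A=\begin{pmatrix}0&B\\B^{t}&0\end{pmatrix}$$ with $B$ an $n\times n$ matrix. A tiling of $R$ is a partition of its faces into tiles, a tile being the union of two faces with a common side (a domino in the quadriculated case, a lozenge in the triangulated case). Let $N$ be the number of tilings of $R$. Each tiling corresponds to a permutation $\sigma$ of $\{1,\dots,n\}$ (the $i$-th black face and the $\sigma(i)$-th white face form a tile), hence to a nonzero monomial in the expansion of $\det B$; the tilings are split into two classes according to the sign of $\sigma$. Then, for every such labelling: 1. If $R$ is quadriculated, then $|\det B|\le 1$, and the two classes are almost balanced: the numbers of their elements differ by at most $1$. 2. If $R$ is triangulated, then $|\det B|=N$, and (at least) one of the two classes is empty. -/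

import Mathlib

/-! ### Regions made of faces of a planar cell decomposition

`F` is the type of faces of a decomposition of the plane into polygons, `V f` is the finite set of
corners of the face `f`, given by integer coordinates, and `pt` is the position in the plane `ℂ` of
a lattice point.  Everything below is used only for the two concrete decompositions
into unit squares and into unit equilateral triangles that are defined at the end. -/

namespace Tilings

/-- The graph of all faces: two different faces are adjacent iff they have a common side,
i.e. (in both decompositions of interest) iff they have exactly two corners in common. -/
def faceGraph {F : Type} (V : F → Finset (ℤ × ℤ)) : SimpleGraph F where
  Adj f g := f ≠ g ∧ (V f ∩ V g).card = 2
  symm := ⟨fun f g h => ⟨h.1.symm, by rw [Finset.inter_comm]; exact h.2⟩⟩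
  loopless := ⟨fun _ h => h.1 rfl⟩

instance {F : Type} [DecidableEq F] (V : F → Finset (ℤ × ℤ)) : DecidableRel (faceGraph V).Adj :=
  fun f g => inferInstanceAs (Decidable (f ≠ g ∧ (V f ∩ V g).card = 2))

/-- The graph `Λ` of a region: its vertices are the faces of `R`, two of them being joined iff
they have a common side. -/
def regionGraph {F : Type} (V : F → Finset (ℤ × ℤ)) (R : Finset F) : SimpleGraph R :=
  (faceGraph V).comap Subtype.val

instance {F : Type} [DecidableEq F] (V : F → Finset (ℤ × ℤ)) (R : Finset F) :
    DecidableRel (regionGraph V R).Adj :=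
  fun f g => inferInstanceAs (Decidable ((faceGraph V).Adj f.1 g.1))

/-- The region as a subset of the plane: the union of its closed faces. -/
def body {F : Type} (V : F → Finset (ℤ × ℤ)) (pt : ℤ × ℤ → ℂ) (R : Finset F) : Set ℂ :=
  ⋃ f ∈ R, convexHull ℝ (pt '' (V f : Set (ℤ × ℤ)))

/-- A tile (domino or lozenge): the union of two faces with a common side. -/
def IsTile {F : Type} [DecidableEq F] (V : F → Finset (ℤ × ℤ)) (t : Finset F) : Prop :=
  ∃ f g : F, (faceGraph V).Adj f g ∧ t = {f, g}

/-- A tiling of the region `R`: a partition of `R` into tiles. -/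
def Tiling {F : Type} [DecidableEq F] (V : F → Finset (ℤ × ℤ)) (R : Finset F) : Type :=
  {P : Finpartition R // ∀ t ∈ P.parts, IsTile V t}

/-- A labelling of the `2 * n` faces of a region with `n` black and `n` white faces
which lists the black faces first. -/
structure Labelling {F : Type} (black : F → Prop) (R : Finset F) (n : ℕ) where
  face : Fin n ⊕ Fin n ≃ R
  black_inl : ∀ i, black (face (Sum.inl i)).1
  white_inr : ∀ i, ¬ black (face (Sum.inr i)).1

/-- The adjacency matrix `A` of `Λ`, with rows and columns ordered by the labelling. -/
def Labelling.A {F : Type} [DecidableEq F] {black : F → Prop} {R : Finset F} {n : ℕ}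
    (ℓ : Labelling black R n) (V : F → Finset (ℤ × ℤ)) :
    Matrix (Fin n ⊕ Fin n) (Fin n ⊕ Fin n) ℤ :=
  ((regionGraph V R).adjMatrix ℤ).submatrix ℓ.face ℓ.face

/-- The block `B` of `A` whose rows are the black faces and whose columns are the white faces. -/
def Labelling.B {F : Type} [DecidableEq F] {black : F → Prop} {R : Finset F} {n : ℕ}
    (ℓ : Labelling black R n) (V : F → Finset (ℤ × ℤ)) : Matrix (Fin n) (Fin n) ℤ :=
  (ℓ.A V).toBlocks₁₂

/-- The tilings whose monomial in the expansion of `det B` has sign `ε`: the monomial belongs to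
the permutation `σ` for which the `i`-th black face and the `σ i`-th white face form a tile. -/
def signClass {F : Type} [DecidableEq F] {black : F → Prop} {R : Finset F} {n : ℕ}
    (V : F → Finset (ℤ × ℤ)) (ℓ : Labelling black R n) (ε : ℤˣ) : Set (Tiling V R) :=
  {T | ∃ σ : Equiv.Perm (Fin n), Equiv.Perm.sign σ = ε ∧
    ∀ i, ({(ℓ.face (Sum.inl i)).1, (ℓ.face (Sum.inr (σ i))).1} : Finset F) ∈ T.1.parts}

/-! ### The quadriculated plane -/

/-- The unit squares of the quadriculated plane, indexed by their lower left corners. -/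
abbrev Square : Type := ℤ × ℤ

/-- The corners of a unit square. -/
def squareCorners (s : Square) : Finset (ℤ × ℤ) :=
  {(s.1, s.2), (s.1 + 1, s.2), (s.1, s.2 + 1), (s.1 + 1, s.2 + 1)}

/-- The position of a point of the square lattice. -/
def squarePt (p : ℤ × ℤ) : ℂ := ⟨(p.1 : ℝ), (p.2 : ℝ)⟩

/-- The chessboard colouring. -/
def squareBlack (s : Square) : Prop := Even (s.1 + s.2)

/-! ### The triangulated plane -/

/-- The unit triangles of the triangulated plane: each unit rhombus, indexed by its
lower left corner, is cut into a triangle pointing up (`true`) and one pointing down (`false`). -/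
abbrev Triangle : Type := (ℤ × ℤ) × Bool

/-- The corners of a unit triangle. -/
def triangleCorners (t : Triangle) : Finset (ℤ × ℤ) :=
  if t.2 then {(t.1.1, t.1.2), (t.1.1 + 1, t.1.2), (t.1.1, t.1.2 + 1)}
  else {(t.1.1 + 1, t.1.2), (t.1.1, t.1.2 + 1), (t.1.1 + 1, t.1.2 + 1)}

/-- The position of a point `p` of the triangular lattice, `p.1 + p.2 * exp (i * π / 3)`. -/
noncomputable def trianglePt (p : ℤ × ℤ) : ℂ :=
  ⟨(p.1 : ℝ) + (p.2 : ℝ) / 2, (p.2 : ℝ) * (Real.sqrt 3 / 2)⟩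

/-- The colouring of the triangles: those pointing up are black. -/
def triangleBlack (t : Triangle) : Prop := t.2 = true

end Tilings

/-! Simple connectedness enters only through one combinatorial consequence, `eq_empty_of_enclosed`:
no nonempty finite set of faces is enclosed by the region. Otherwise a continuous logarithm of `z -
p`, with `p` the centre of an enclosed face, would exist on the region, although the winding number
of the boundary around `p` is not zero. It follows that cochains closed on the faces of `R` have
potentials there.

Quadriculated case: suppose a prime `q` divides `det B`, and take a kernel vector of `B` over `ZMod
q`. With signs alternating by rows, it becomes a closed cochain on the edges, hence the differences
of a potential `φ` on the vertices. Being a kernel vector only requires certain values of `φ` to be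
equal, so `φ` may be replaced by the indicator of one of its levels. This gives a nonzero integral
kernel vector, so `det B = 0`. Hence no prime divides a nonzero `det B`.

Triangulated case: the difference of two tilings is the coboundary of an integer function `w` that
vanishes off the interior vertices. Where `w > 0`, an extremal choice of vertex, using the height
function of the first tiling, finds three lozenges filling a hexagon. Rotating them lowers `w` at
one vertex and changes the permutation by a 3-cycle, which is even. Repetition joins any two
tilings, so all monomials of `det B` have the same sign. -/

/-! ### Winding numbers: a simply connected region encloses no faces -/

/-- A continuous logarithm of `z - p` on a simply connected set, in discrete form. -/
theorem exists_log_primitive {S : Set ℂ} (hS : IsSimplyConnected S) {p : ℂ} (hp : p ∉ S) :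
    ∃ l : ℂ → ℂ, ∀ z w, segment ℝ z w ⊆ S → l w - l z = Complex.log ((w - p) / (z - p)) := by
  classical
  have := hS.simplyConnectedSpace
  have hne : ∀ z : S, (z : ℂ) - p ≠ 0 := fun z h => hp (sub_eq_zero.1 h ▸ z.2)
  let q : C(S, {z : ℂ // z ≠ 0}) :=
    ⟨fun z => ⟨(z : ℂ) - p, hne z⟩, by fun_prop⟩
  let E : C(ℂ, {z : ℂ // z ≠ 0}) := ⟨_, Complex.isCoveringMap_exp.continuous⟩
  have cov : IsCoveringMap E := Complex.isCoveringMap_exp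
  obtain ⟨s⟩ : Nonempty S := hS.nonempty.to_subtype
  have e0 : E ⁻¹' {q s} := ⟨Complex.log (s - p), Subtype.ext (Complex.exp_log (hne s))⟩
  let γ : ∀ z : S, Path.Homotopic.Quotient s z := fun z => .mk (PathConnectedSpace.somePath s z)
  -- Endpoint of the lift of a path from `s` through the covering `exp`; all paths with the same
  -- ends are homotopic, so the choice of path is immaterial.
  let l : ∀ z : S, E ⁻¹' {q z} := fun z => cov.monodromy ((γ z).map q) e0
  have key : ∀ (z w : S) (δ : Path z w), l w = cov.monodromy ((Path.Homotopic.Quotient.mk δ).map q) (l z) := by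
    intro z w δ
    have : γ w = (γ z).trans (.mk δ) := Subsingleton.elim _ _
    show cov.monodromy ((γ w).map q) e0 = _
    rw [this, ← cov.monodromy_trans_apply]
    exact congrArg (fun γ => cov.monodromy γ e0)
      (congrArg Path.Homotopic.Quotient.mk (Path.map_trans _ _ q.continuous))
  refine ⟨fun z => if h : z ∈ S then (l ⟨z, h⟩ : ℂ) else 0, fun z w h => ?_⟩
  have hz : z ∈ S := h (left_mem_segment ℝ z w)
  have hw : w ∈ S := h (right_mem_segment ℝ z w)
  simp only [hz, hw, dif_pos]
  have hmem : ∀ t : unitInterval, z + (t : ℝ) • (w - z) ∈ S := fun t =>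
    h (by rw [segment_eq_image']; exact ⟨t, t.2, rfl⟩)
  let δ : Path (⟨z, hz⟩ : S) ⟨w, hw⟩ :=
    { toFun := fun t => ⟨z + (t : ℝ) • (w - z), hmem t⟩
      continuous_toFun := by fun_prop
      source' := by simp
      target' := by simp }
  have hzp : z - p ≠ 0 := hne ⟨z, hz⟩
  -- A quotient in `(-∞, 0]` would mean that the segment has already passed through `p`, at
  -- parameter `-1 / c.re`. So the principal logarithm lifts the whole segment.
  have hslit : ∀ t : unitInterval, (z + (t : ℝ) • (w - z) - p) / (z - p) ∈ Complex.slitPlane := by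
    intro t
    by_contra hcon
    set c := (w - z) / (z - p) with hc
    have e1 : (z + (t : ℝ) • (w - z) - p) / (z - p) = 1 + (t : ℝ) * c := by
      rw [hc, Complex.real_smul]; field_simp; ring
    rw [e1, Complex.mem_slitPlane_iff, not_or, not_lt, not_not] at hcon
    simp only [Complex.add_re, Complex.one_re, Complex.re_ofReal_mul, Complex.add_im,
      Complex.one_im, Complex.im_ofReal_mul, zero_add] at hcon
    obtain ⟨h1, h2⟩ := hcon
    have ht0 : (t : ℝ) ≠ 0 := fun h0 => by rw [h0] at h1; norm_num at h1
    have ht : 0 < (t : ℝ) := lt_of_le_of_ne t.2.1 (Ne.symm ht0)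
    have him : c.im = 0 := by simpa [ht0] using h2
    have hre : c.re < 0 := by nlinarith
    have ht1 : (t : ℝ) ≤ 1 := t.2.2
    have hcre : -1 / c.re ∈ Set.Icc (0 : ℝ) 1 := by
      constructor
      · exact div_nonneg_of_nonpos (by norm_num) hre.le
      · rw [div_le_one_of_neg hre]; nlinarith
    apply hp
    have := hmem ⟨-1 / c.re, hcre⟩
    have hcc : c = (c.re : ℂ) := by apply Complex.ext <;> simp [him]
    have hwz : w - z = (c.re : ℂ) * (z - p) := by rw [← hcc, hc]; field_simp
    have hcr : (c.re : ℂ) ≠ 0 := by exact_mod_cast hre.ne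
    convert this using 1
    rw [Complex.real_smul, hwz]
    push_cast
    field_simp
    ring
  let Γ : Path ((l ⟨z, hz⟩ : ℂ)) ((l ⟨z, hz⟩ : ℂ) + Complex.log ((w - p) / (z - p))) :=
    { toFun := fun t => (l ⟨z, hz⟩ : ℂ) + Complex.log ((z + (t : ℝ) • (w - z) - p) / (z - p))
      continuous_toFun := by
        refine continuous_const.add (Continuous.clog (by fun_prop) hslit)
      source' := by simp [div_self hzp]
      target' := by simp }
  have hEl : ∀ z : S, Complex.exp (l z) = z - p := fun z => congrArg Subtype.val (l z).2
  have hwp : w - p ≠ 0 := hne ⟨w, hw⟩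
  have hey : E ((l ⟨z, hz⟩ : ℂ) + Complex.log ((w - p) / (z - p))) = q ⟨w, hw⟩ := by
    apply Subtype.ext
    show Complex.exp _ = w - p
    rw [Complex.exp_add, hEl, Complex.exp_log (div_ne_zero hwp hzp)]
    field_simp
  have := cov.monodromy_eq_of_map_eq (γ := (Path.Homotopic.Quotient.mk δ).map q)
    (ex := l ⟨z, hz⟩) (ey := ⟨_, hey⟩) (.mk Γ) (by
      refine congr_arg Path.Homotopic.Quotient.mk ?_
      ext t
      show Complex.exp ((l ⟨z, hz⟩ : ℂ) + Complex.log ((z + (t : ℝ) • (w - z) - p) / (z - p))) =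
        (z + (t : ℝ) • (w - z)) - p
      have hne' : z + (t : ℝ) • (w - z) - p ≠ 0 := hne ⟨_, hmem t⟩
      rw [Complex.exp_add, hEl, Complex.exp_log (div_ne_zero hne' hzp)]
      field_simp)
  rw [key _ _ δ, this]
  simp

/-- After rotation by `u` both arguments lie in `(-π/2, π/2)`, so their difference needs no
correction by `2π`. -/
theorem Complex.log_div_of_re_pos {u a b : ℂ} (ha : 0 < (u * a).re) (hb : 0 < (u * b).re) :
    Complex.log (b / a) = Complex.log (u * b) - Complex.log (u * a) := by
  have hua : u * a ≠ 0 := fun h => by simp [h] at ha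
  have hub : u * b ≠ 0 := fun h => by simp [h] at hb
  have hu : u ≠ 0 := left_ne_zero_of_mul hua
  have h1 := abs_lt.1 (Complex.abs_arg_lt_pi_div_two_iff.2 (Or.inl ha))
  have h2 := abs_lt.1 (Complex.abs_arg_lt_pi_div_two_iff.2 (Or.inl hb))
  have h3 : (u * a).arg ≠ Real.pi := by linarith [Real.pi_pos]
  rw [show b / a = (u * b) * (u * a)⁻¹ by field_simp,
    Complex.log_mul hub (inv_ne_zero hua), Complex.log_inv _ h3, sub_eq_add_neg]
  rw [Complex.arg_inv, if_neg h3]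
  constructor <;> linarith

namespace Tilings

/-- In a decomposition of the plane into faces with sides labelled by `K`, a simply connected
region leaves no bounded set of faces enclosed: every finite set `U` of faces outside the region
whose neighbours all lie in `U` or in the region is empty. -/
theorem eq_empty_of_enclosed {F K : Type} [DecidableEq F] [Fintype K] [DecidableEq K] [Nonempty K]
    {V : F → Finset (ℤ × ℤ)} {pt : ℤ × ℤ → ℂ} (s : F → K → ℤ × ℤ) (next : Equiv.Perm K)
    (nb : F × K → F × K)
    (hV : ∀ f, V f = Finset.univ.image (s f))
    (hinv : ∀ x, nb (nb x) = x)
    (hnb : ∀ x, s (nb x).1 (nb x).2 = s x.1 (next x.2))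
    (hne : ∀ x, (nb x).1 ≠ x.1)
    (hcentre : ∀ f₀, ∃ p r : ℂ, r ≠ 0 ∧ r ≠ 1 ∧
      (∀ k, pt (s f₀ (next k)) - p = r * (pt (s f₀ k) - p)) ∧
      ∀ f, f ≠ f₀ → ∃ u : ℂ, ∀ k, 0 < (u * (pt (s f k) - p)).re)
    {R : Finset F} (hR : IsSimplyConnected (body V pt R)) {U : Finset F} (hUR : Disjoint U R)
    (hU : ∀ f ∈ U, ∀ k, (nb (f, k)).1 ∈ U ∨ (nb (f, k)).1 ∈ R) : U = ∅ := by
  by_contra hcon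
  obtain ⟨f₀, hf₀⟩ := Finset.nonempty_iff_ne_empty.2 hcon
  obtain ⟨p, r, hr0, hr1, hp, hhalf⟩ := hcentre f₀
  have hpS : p ∉ body V pt R := by
    intro h
    simp only [body, Set.mem_iUnion] at h
    obtain ⟨f, hf, hpf⟩ := h
    have hff : f ≠ f₀ := fun e => (Finset.disjoint_left.1 hUR hf₀) (e ▸ hf)
    obtain ⟨u, hu⟩ := hhalf f hff
    have hconv : Convex ℝ {z : ℂ | 0 < (u * (z - p)).re} := by
      intro z hz w hw a b ha hb hab
      simp only [Set.mem_ofPred_eq] at *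
      have e : u * (a • z + b • w - p) = a * (u * (z - p)) + b * (u * (w - p)) := by
        have : (a : ℂ) + b = 1 := by exact_mod_cast hab
        rw [Complex.real_smul, Complex.real_smul]
        linear_combination (-u * p) * this * (-1)
      rw [e, Complex.add_re, Complex.re_ofReal_mul, Complex.re_ofReal_mul]
      rcases ha.eq_or_lt with rfl | ha
      · have : b = 1 := by linarith
        subst this; simpa using hw
      · nlinarith [mul_pos ha hz, mul_nonneg hb hw.le]
    have := convexHull_min (s := pt '' (V f : Set (ℤ × ℤ))) (by
      rintro _ ⟨v, hv, rfl⟩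
      rw [hV] at hv
      simp only [Finset.coe_image, Finset.coe_univ, Set.image_univ, Set.mem_range] at hv
      obtain ⟨k, rfl⟩ := hv
      exact hu k) hconv hpf
    simp at this
  obtain ⟨l, hl⟩ := exists_log_primitive hR hpS
  have hlog : ∀ f, f ≠ f₀ → ∃ φ : ℤ × ℤ → ℂ, ∀ i j,
      Complex.log ((pt (s f j) - p) / (pt (s f i) - p)) = φ (s f j) - φ (s f i) := by
    intro f hf
    obtain ⟨u, hu⟩ := hhalf f hf
    exact ⟨fun v => Complex.log (u * (pt v - p)), fun i j =>
      Complex.log_div_of_re_pos (hu i) (hu j)⟩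
  have htele : ∀ (f : F) (φ : ℤ × ℤ → ℂ), ∑ k, (φ (s f (next k)) - φ (s f k)) = 0 := by
    intro f φ
    rw [Finset.sum_sub_distrib, Equiv.sum_comp next (fun k => φ (s f k)), sub_self]
  let L : F × K → ℂ := fun x =>
    Complex.log ((pt (s x.1 (next x.2)) - p) / (pt (s x.1 x.2) - p))
  -- The defect between the principal logarithm along a side and the increment of `l`. Off the
  -- region `l` is arbitrary, but there only its telescoping around a face is used.
  let D : F × K → ℂ := fun x => L x - (l (pt (s x.1 (next x.2))) - l (pt (s x.1 x.2)))
  have hnb' : ∀ x, s (nb x).1 (next (nb x).2) = s x.1 x.2 := fun x => by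
    rw [← hnb (nb x), hinv]
  have hDR : ∀ x, x.1 ∈ R → D x = 0 := by
    intro x hx
    refine sub_eq_zero.2 (hl _ _ ?_).symm
    have hmem : ∀ k, pt (s x.1 k) ∈ convexHull ℝ (pt '' (V x.1 : Set (ℤ × ℤ))) := fun k =>
      subset_convexHull ℝ _ ⟨_, by rw [hV]; simp, rfl⟩
    exact ((convex_convexHull ℝ _).segment_subset (hmem _) (hmem _)).trans
      (Set.subset_biUnion_of_mem (u := fun f => convexHull ℝ (pt '' (V f : Set (ℤ × ℤ)))) hx)
  -- `log` is not odd under inversion at argument `π`; the half-plane containing a face other than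
  -- `f₀` excludes this. Every side borders such a face.
  have hL' : ∀ x, x.1 ≠ f₀ → L x + L (nb x) = 0 := by
    intro x hx
    obtain ⟨φ, hφ⟩ := hlog x.1 hx
    have h2 : L (nb x) =
        Complex.log ((pt (s x.1 x.2) - p) / (pt (s x.1 (next x.2)) - p)) := by
      simp only [L, hnb', hnb]
    rw [h2]
    simp only [L, hφ]
    ring
  have hL : ∀ x, L x + L (nb x) = 0 := by
    intro x
    by_cases hx : x.1 = f₀
    · have := hL' (nb x) (fun h => hne x (h.trans hx.symm))
      rwa [hinv, add_comm] at this
    · exact hL' x hx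
  have hD : ∀ x, D x + D (nb x) = 0 := by
    intro x
    have := hL x
    simp only [D, hnb, hnb']
    linear_combination this
  have hDne : ∀ f, f ≠ f₀ → ∑ k, D (f, k) = 0 := by
    intro f hf
    obtain ⟨φ, hφ⟩ := hlog f hf
    simp only [D, L, hφ]
    rw [Finset.sum_sub_distrib, htele, htele f (fun v => l (pt v)), sub_zero]
  have hD0 : ∑ k, D (f₀, k) = Fintype.card K * Complex.log r := by
    have hsrc : ∀ k, pt (s f₀ k) - p ≠ 0 := by
      intro k h
      obtain ⟨φ, hφ⟩ := hhalf (nb (f₀, next.symm k)).1 (hne _)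
      have := hφ (nb (f₀, next.symm k)).2
      rw [hnb] at this
      simp [h] at this
    have hLr : ∀ k, L (f₀, k) = Complex.log r := by
      intro k
      simp only [L, hp]
      rw [mul_div_assoc, div_self (hsrc k), mul_one]
    simp only [D, hLr]
    rw [Finset.sum_sub_distrib, htele f₀ (fun v => l (pt v)), sub_zero]
    simp
  -- The same sum is computed in two ways: face by face only `f₀` contributes; side by side, those
  -- inside `U` cancel in pairs and those bordering `R` have no defect.
  have hsum : ∑ x ∈ U ×ˢ (Finset.univ : Finset K), D x = Fintype.card K * Complex.log r := by
    rw [Finset.sum_product, Finset.sum_eq_single f₀ (fun f _ hf => hDne f hf)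
      (fun h => absurd hf₀ h), hD0]
  have hzero : ∑ x ∈ U ×ˢ (Finset.univ : Finset K), D x = 0 := by
    rw [← Finset.sum_filter_add_sum_filter_not _ (fun x => (nb x).1 ∈ U)]
    have h2 : ∑ x ∈ U ×ˢ (Finset.univ : Finset K) with (nb x).1 ∉ U, D x = 0 := by
      refine Finset.sum_eq_zero fun x hx => ?_
      simp only [Finset.mem_filter, Finset.mem_product] at hx
      have := hDR (nb x) ((hU x.1 hx.1.1 x.2).resolve_left hx.2)
      have h := hD x
      rwa [this, add_zero] at h
    rw [h2, add_zero]
    refine Finset.sum_involution (fun x _ => nb x) (fun x _ => hD x)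
      (fun x _ _ h => hne x (congrArg Prod.fst h)) (fun x hx => ?_) (fun x _ => hinv x)
    simp only [Finset.mem_filter, Finset.mem_product, Finset.mem_univ, and_true] at hx ⊢
    exact ⟨hx.2, by rw [hinv]; exact hx.1⟩
  rw [hsum] at hzero
  rcases mul_eq_zero.1 hzero with h | h
  · exact Fintype.card_ne_zero (Nat.cast_eq_zero.1 h)
  · exact hr1 (by rw [← Complex.exp_log hr0, h, Complex.exp_zero])

/-- The corners of a square in counterclockwise order. -/
def squareCorner (f : Square) : Fin 4 → ℤ × ℤ :=
  ![f, (f.1 + 1, f.2), (f.1 + 1, f.2 + 1), (f.1, f.2 + 1)]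

/-- The square on the other side of a side, with the index of that side in it. -/
def squareNeighbour (x : Square × Fin 4) : Square × Fin 4 :=
  (![(x.1.1, x.1.2 - 1), (x.1.1 + 1, x.1.2), (x.1.1, x.1.2 + 1), (x.1.1 - 1, x.1.2)] x.2,
    ![2, 3, 0, 1] x.2)

theorem square_eq_empty_of_enclosed {R : Finset Square}
    (hR : IsSimplyConnected (body squareCorners squarePt R)) {U : Finset Square}
    (hUR : Disjoint U R)
    (hU : ∀ f ∈ U, ∀ k, (squareNeighbour (f, k)).1 ∈ U ∨ (squareNeighbour (f, k)).1 ∈ R) :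
    U = ∅ := by
  refine eq_empty_of_enclosed squareCorner (finRotate 4) squareNeighbour ?_ ?_ ?_ ?_ ?_ hR hUR hU
  · rintro ⟨a, b⟩
    ext v
    simp [squareCorners, squareCorner, Fin.exists_fin_succ, eq_comm]
    tauto
  · rintro ⟨⟨a, b⟩, k⟩
    fin_cases k <;> simp [squareNeighbour]
  · rintro ⟨⟨a, b⟩, k⟩
    fin_cases k <;> simp [squareNeighbour, squareCorner]
  · rintro ⟨⟨a, b⟩, k⟩
    fin_cases k <;> simp [squareNeighbour]
  · rintro ⟨a, b⟩
    refine ⟨⟨a + 1 / 2, b + 1 / 2⟩, Complex.I, Complex.I_ne_zero, ?_, ?_, ?_⟩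
    · intro h; have := congrArg Complex.re h; simp at this
    · intro k
      fin_cases k <;> apply Complex.ext <;> simp [squarePt, squareCorner] <;> ring
    · rintro ⟨x, y⟩ hne
      -- Another square lies beyond one of the four side lines of the central one.
      have : a + 1 ≤ x ∨ x + 1 ≤ a ∨ b + 1 ≤ y ∨ y + 1 ≤ b := by
        by_contra hcon
        apply hne
        simp only [Prod.mk.injEq]
        omega
      rcases this with h | h | h | h
      · have h' : (a : ℝ) + 1 ≤ x := by exact_mod_cast h
        refine ⟨1, fun k => ?_⟩
        fin_cases k <;> simp [squarePt, squareCorner] <;> linarith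
      · have h' : (x : ℝ) + 1 ≤ a := by exact_mod_cast h
        refine ⟨-1, fun k => ?_⟩
        fin_cases k <;> simp [squarePt, squareCorner] <;> linarith
      · have h' : (b : ℝ) + 1 ≤ y := by exact_mod_cast h
        refine ⟨-Complex.I, fun k => ?_⟩
        fin_cases k <;> simp [squarePt, squareCorner] <;> linarith
      · have h' : (y : ℝ) + 1 ≤ b := by exact_mod_cast h
        refine ⟨Complex.I, fun k => ?_⟩
        fin_cases k <;> simp [squarePt, squareCorner] <;> linarith

/-- The corners of a triangle in counterclockwise order. -/
def triangleCorner (f : Triangle) : Fin 3 → ℤ × ℤ :=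
  if f.2 then ![f.1, (f.1.1 + 1, f.1.2), (f.1.1, f.1.2 + 1)]
  else ![(f.1.1 + 1, f.1.2 + 1), (f.1.1, f.1.2 + 1), (f.1.1 + 1, f.1.2)]

/-- The triangle on the other side of a side, with the index of that side in it. -/
def triangleNeighbour (x : Triangle × Fin 3) : Triangle × Fin 3 :=
  ((if x.1.2 then
      (![(x.1.1.1, x.1.1.2 - 1), x.1.1, (x.1.1.1 - 1, x.1.1.2)] x.2, false)
    else
      (![(x.1.1.1, x.1.1.2 + 1), x.1.1, (x.1.1.1 + 1, x.1.1.2)] x.2, true)), x.2)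

theorem triangle_eq_empty_of_enclosed {R : Finset Triangle}
    (hR : IsSimplyConnected (body triangleCorners trianglePt R)) {U : Finset Triangle}
    (hUR : Disjoint U R)
    (hU : ∀ f ∈ U, ∀ k, (triangleNeighbour (f, k)).1 ∈ U ∨ (triangleNeighbour (f, k)).1 ∈ R) :
    U = ∅ := by
  have h3 : Real.sqrt 3 * Real.sqrt 3 = 3 := Real.mul_self_sqrt (by norm_num)
  refine eq_empty_of_enclosed triangleCorner (finRotate 3) triangleNeighbour
    ?_ ?_ ?_ ?_ ?_ hR hUR hU
  · rintro ⟨⟨a, b⟩, c⟩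
    ext v
    cases c <;> simp [triangleCorners, triangleCorner, Fin.exists_fin_succ, eq_comm]
    tauto
  · rintro ⟨⟨⟨a, b⟩, c⟩, k⟩
    cases c <;> fin_cases k <;> simp [triangleNeighbour]
  · rintro ⟨⟨⟨a, b⟩, c⟩, k⟩
    cases c <;> fin_cases k <;> simp [triangleNeighbour, triangleCorner]
  · rintro ⟨⟨⟨a, b⟩, c⟩, k⟩
    cases c <;> fin_cases k <;> simp [triangleNeighbour]
  -- Another triangle lies beyond one of the three side lines, on which `x`, `y` or `x + y` is
  -- constant. The centre has offset `1/3` or `2/3` in both lattice coordinates, hence the factor 3.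
  · have key : ∀ (c : Bool) (a b x y : ℤ) (d : Bool), ((x, y), d) ≠ ((a, b), c) →
        ∃ ε : ℤ, (ε = 1 ∨ ε = -1) ∧ ∃ i j : ℤ, ((i = 1 ∧ j = 0) ∨ (i = 0 ∧ j = 1) ∨ (i = 1 ∧ j = 1)) ∧
          ∀ k, 0 < ε * (3 * (i * ((triangleCorner ((x, y), d) k).1 - a) +
              j * ((triangleCorner ((x, y), d) k).2 - b)) - (i + j) * (if c then 1 else 2)) := by
      intro c a b x y d hne
      by_cases h1 : (c = true ∧ x < a) ∨ (c = false ∧ a < x)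
      · refine ⟨if c then -1 else 1, by cases c <;> simp, 1, 0, by simp, fun k => ?_⟩
        cases c <;> cases d <;> fin_cases k <;> simp [triangleCorner] <;> simp at h1 <;> omega
      by_cases h2 : (c = true ∧ y < b) ∨ (c = false ∧ b < y)
      · refine ⟨if c then -1 else 1, by cases c <;> simp, 0, 1, by simp, fun k => ?_⟩
        cases c <;> cases d <;> fin_cases k <;> simp [triangleCorner] <;> simp at h2 <;> omega
      refine ⟨if c then 1 else -1, by cases c <;> simp, 1, 1, by simp, fun k => ?_⟩
      cases c <;> cases d <;> fin_cases k <;> simp [triangleCorner] <;>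
        simp at h1 h2 hne <;> omega
    rintro ⟨⟨a, b⟩, c⟩
    refine ⟨trianglePt (a, b) + (if c then 1 else 2) * ⟨1 / 2, Real.sqrt 3 / 6⟩,
      ⟨-1 / 2, Real.sqrt 3 / 2⟩, ?_, ?_, ?_, ?_⟩
    · intro h; have := congrArg Complex.re h; norm_num at this
    · intro h; have := congrArg Complex.re h; norm_num at this
    · intro k
      cases c <;> fin_cases k <;> apply Complex.ext <;>
        simp [trianglePt, triangleCorner] <;> linarith
    · rintro ⟨⟨x, y⟩, d⟩ hne
      obtain ⟨ε, hε, i, j, hij, hk⟩ := key c a b x y d hne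
      -- The real parts of the products with these two numbers are the two lattice coordinates.
      refine ⟨ε * (i * ⟨1, Real.sqrt 3 / 3⟩ + j * ⟨0, -(2 * Real.sqrt 3 / 3)⟩), fun k => ?_⟩
      have hk' : (0 : ℝ) < ε * (3 * (i * ((triangleCorner ((x, y), d) k).1 - a) +
              j * ((triangleCorner ((x, y), d) k).2 - b)) - (i + j) * (if c then 1 else 2)) := by
        have := hk k
        split_ifs at this ⊢ <;> exact_mod_cast this
      generalize triangleCorner ((x, y), d) k = v at hk'
      refine (div_pos hk' (show (0 : ℝ) < 3 by norm_num)).trans_eq (Eq.symm ?_)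
      cases c <;> simp [trianglePt] <;> ring_nf <;> rw [show Real.sqrt 3 ^ 2 = 3 by rw [sq, h3]] <;> ring

end Tilings

/-! ### Closed cochains and their potentials -/

/-- If every nonempty part of `S` has an element whose curl can be adjusted freely along an edge
not affecting the rest of that part, then every cochain can be changed on the free edges into
one without curl on `S`. -/
theorem exists_closed_extension {E V A : Type*} [AddCommGroup A] [DecidableEq E] [DecidableEq V]
    (curl : (E → A) →+ (V → A)) (free : Set E) (S : Finset V)
    (h : ∀ T ⊆ S, T.Nonempty → ∃ v ∈ T, ∃ e ∈ free,
      (∀ a, ∃ b, curl (Pi.single e b) v = a) ∧ ∀ u ∈ T, u ≠ v → ∀ b, curl (Pi.single e b) u = 0)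
    (c : E → A) : ∃ c' : E → A, (∀ e, e ∉ free → c' e = c e) ∧ ∀ v ∈ S, curl c' v = 0 := by
  induction S using Finset.strongInduction with
  | H S ih =>
    rcases S.eq_empty_or_nonempty with rfl | hS
    · exact ⟨c, fun _ _ => rfl, by simp⟩
    obtain ⟨v, hv, e, he, hsurj, hother⟩ := h S subset_rfl hS
    obtain ⟨c', hc', hcurl⟩ := ih (S.erase v) (Finset.erase_ssubset hv)
      (fun T hT => h T (hT.trans (Finset.erase_subset _ _)))
    -- The curl at `v` is repaired last, along an edge that leaves the curl on the rest of `S`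
    -- unchanged.
    obtain ⟨b, hb⟩ := hsurj (-curl c' v)
    refine ⟨c' + Pi.single e b, fun e' he' => ?_, fun u hu => ?_⟩
    · have : e' ≠ e := fun h => he' (h ▸ he)
      simp [this, hc' e' he']
    · rw [map_add, Pi.add_apply]
      by_cases huv : u = v
      · rw [huv, hb, add_neg_cancel]
      · rw [hother u hu huv, hcurl u (Finset.mem_erase.2 ⟨huv, hu⟩), add_zero]

theorem Int.exists_antiderivative {A : Type*} [AddCommGroup A] (d : ℤ → A) :
    ∃ φ : ℤ → A, ∀ n, φ (n + 1) - φ n = d n := by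
  refine ⟨fun n => ∑ i ∈ Finset.Ico 0 n, d i - ∑ i ∈ Finset.Ico n 0, d i, fun n => ?_⟩
  beta_reduce
  rcases le_or_gt 0 n with h | h
  · have e : Finset.Ico 0 (n + 1) = insert n (Finset.Ico 0 n) := by
      ext i; simp only [Finset.mem_Ico, Finset.mem_insert]; omega
    rw [e, Finset.sum_insert (by simp), Finset.Ico_eq_empty (by omega : ¬ n + 1 < 0),
      Finset.Ico_eq_empty (by omega : ¬ n < 0)]
    simp
  · have e : Finset.Ico n 0 = insert n (Finset.Ico (n + 1) 0) := by
      ext i; simp only [Finset.mem_Ico, Finset.mem_insert]; omega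
    rw [e, Finset.sum_insert (by simp), Finset.Ico_eq_empty (by omega : ¬ 0 < n + 1),
      Finset.Ico_eq_empty (by omega : ¬ 0 < n)]
    simp

/-- Potentials of cochains on the square grid. -/
theorem exists_grid_potential {A : Type*} [AddCommGroup A] (dx dy : ℤ → ℤ → A) (y₀ : ℤ) :
    ∃ φ : ℤ → ℤ → A, (∀ x y, φ x (y + 1) - φ x y = dy x y) ∧
      ∀ x y, (∀ t, min y₀ y ≤ t → t < max y₀ y →
        dx x t + dy (x + 1) t - dx x (t + 1) - dy x t = 0) → φ (x + 1) y - φ x y = dx x y := by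
  obtain ⟨a, ha⟩ := Int.exists_antiderivative (fun x => dx x y₀)
  choose b hb using fun x => Int.exists_antiderivative (dy x)
  -- Integrate along the row `y₀`, then along each column.
  refine ⟨fun x y => a x + b x y - b x y₀, fun x y => ?_, fun x y h => ?_⟩
  · rw [← hb x y]; beta_reduce; abel
  · beta_reduce
    rcases le_total y₀ y with hy | hy
    · induction y, hy using Int.leInduction with
      | base => rw [← ha x]; abel
      | succ y hy ih =>
        have h1 := ih (fun t h1 h2 => h t (by omega) (by omega))
        have h2 := h y (by omega) (by omega)
        beta_reduce at h1
        rw [← hb, ← hb, ← h1] at h2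
        rw [← sub_eq_zero, ← h2]
        abel
    · induction y, hy using Int.leInductionDown with
      | base => rw [← ha x]; abel
      | pred y hy ih =>
        have h1 := ih (fun t h1 h2 => h t (by omega) (by omega))
        have h2 := h (y - 1) (by omega) (by omega)
        have e := hb x (y - 1)
        have e' := hb (x + 1) (y - 1)
        rw [sub_add_cancel] at e e' h2
        beta_reduce at h1
        rw [← e, ← e', ← h1] at h2
        rw [eq_comm, ← sub_eq_zero, ← h2]
        abel

theorem Finset.exists_box (S : Finset (ℤ × ℤ)) :
    ∃ N : ℤ, ∀ v ∈ S, -N ≤ v.1 ∧ v.1 ≤ N ∧ -N ≤ v.2 ∧ v.2 ≤ N := by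
  refine ⟨∑ v ∈ S, (|v.1| + |v.2|), fun v hv => ?_⟩
  have := Finset.single_le_sum (f := fun v : ℤ × ℤ => |v.1| + |v.2|)
    (fun v _ => by positivity) hv
  have h1 := abs_le.1 (le_refl |v.1|)
  have h2 := abs_le.1 (le_refl |v.2|)
  have h3 := abs_nonneg v.1
  have h4 := abs_nonneg v.2
  omega

namespace Tilings

/-- The sum of a cochain around a square; `c (v, 0)` and `c (v, 1)` are its values on the
horizontal and on the vertical edge that start at `v`. -/
def squareCurl (A : Type*) [AddCommGroup A] :
    ((ℤ × ℤ) × Fin 2 → A) →+ (Square → A) where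
  toFun c f := c (f, 0) + c ((f.1 + 1, f.2), 1) - c ((f.1, f.2 + 1), 0) - c (f, 1)
  map_zero' := by ext; simp
  map_add' c c' := by ext; simp; abel

/-- The cochain is first made closed on a whole box by changing it on edges that border no face of
`R`; the box has no topology, so integration along rows and columns applies. The change is possible
because a set of faces outside `R` is never enclosed: one of them has a side leading out of both the
set and `R`. -/
theorem square_exists_potential {R : Finset Square}
    (hR : IsSimplyConnected (body squareCorners squarePt R)) {A : Type*} [AddCommGroup A]
    (c : (ℤ × ℤ) × Fin 2 → A) (hc : ∀ f ∈ R, squareCurl A c f = 0) :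
    ∃ φ : ℤ × ℤ → A, ∀ f ∈ R, φ (f.1 + 1, f.2) - φ f = c (f, 0) ∧
      φ (f.1, f.2 + 1) - φ f = c (f, 1) ∧
      φ (f.1 + 1, f.2 + 1) - φ (f.1, f.2 + 1) = c ((f.1, f.2 + 1), 0) ∧
      φ (f.1 + 1, f.2 + 1) - φ (f.1 + 1, f.2) = c ((f.1 + 1, f.2), 1) := by
  obtain ⟨N, hN⟩ := R.exists_box
  let B : Finset Square := Finset.Icc (-N) N ×ˢ Finset.Icc (-N) N
  obtain ⟨c', hc', hcurl⟩ := exists_closed_extension (squareCurl A)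
    {e | e.1 ∉ R ∧ (if e.2 = 0 then (e.1.1, e.1.2 - 1) else (e.1.1 - 1, e.1.2)) ∉ R} (B \ R)
    (by
      intro T hT hne
      by_contra hcon
      refine hne.ne_empty (square_eq_empty_of_enclosed hR
        (Finset.disjoint_of_subset_left hT Finset.sdiff_disjoint) fun f hf k => ?_)
      by_contra hk
      rw [not_or] at hk
      have hfR : f ∉ R := (Finset.mem_sdiff.1 (hT hf)).2
      refine hcon ⟨f, hf, ![(f, 0), ((f.1 + 1, f.2), 1), ((f.1, f.2 + 1), 0), (f, 1)] k,
        ?_, fun a => ⟨![a, a, -a, -a] k, ?_⟩, fun u hu huf b => ?_⟩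
      · fin_cases k <;> simpa [squareNeighbour, hfR] using hk.2
      · fin_cases k <;> simp [squareCurl, Prod.ext_iff]
      · have hu' : u ≠ (squareNeighbour (f, k)).1 := fun h => hk.1 (h ▸ hu)
        obtain ⟨f1, f2⟩ := f
        obtain ⟨u1, u2⟩ := u
        simp only [ne_eq, Prod.mk.injEq] at huf
        fin_cases k <;> simp [squareNeighbour] at hu' <;>
          simp [squareCurl, Pi.single_apply, Prod.ext_iff] <;> grind) c
  obtain ⟨φ, hy, hx⟩ := exists_grid_potential (fun x y => c' ((x, y), 0))
    (fun x y => c' ((x, y), 1)) (-N)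
  have hcR : ∀ f ∈ R, c' (f, 0) = c (f, 0) ∧ c' (f, 1) = c (f, 1) ∧
      c' ((f.1, f.2 + 1), 0) = c ((f.1, f.2 + 1), 0) ∧
      c' ((f.1 + 1, f.2), 1) = c ((f.1 + 1, f.2), 1) := by
    intro f hf
    refine ⟨hc' _ ?_, hc' _ ?_, hc' _ ?_, hc' _ ?_⟩ <;> simp [hf]
  have hB : ∀ f ∈ B, squareCurl A c' f = 0 := by
    intro f hf
    by_cases hfR : f ∈ R
    · rw [← hc f hfR]
      obtain ⟨h1, h2, h3, h4⟩ := hcR f hfR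
      simp [squareCurl, h1, h2, h3, h4]
    · exact hcurl f (Finset.mem_sdiff.2 ⟨hf, hfR⟩)
  have hx' : ∀ x y, -N ≤ x → x ≤ N → -N ≤ y → y ≤ N + 1 → φ (x + 1) y - φ x y = c' ((x, y), 0) :=
    fun x y h1 h2 h3 h4 => hx x y fun t ht1 ht2 =>
      hB (x, t) (by simp only [B, Finset.mem_product, Finset.mem_Icc]; omega)
  refine ⟨fun v => φ v.1 v.2, fun f hf => ?_⟩
  obtain ⟨h1, h2, h3, h4⟩ := hcR f hf
  obtain ⟨b1, b2, b3, b4⟩ := hN f hf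
  exact ⟨(hx' _ _ b1 b2 b3 (by omega)).trans h1, (hy _ _).trans h2,
    (hx' _ _ b1 b2 (by omega) (by omega)).trans h3, (hy _ _).trans h4⟩

/-- The position of the white triangle on the other side of the `k`-th side of the black triangle
at `v`. -/
def whiteAt (v : ℤ × ℤ) (k : Fin 3) : ℤ × ℤ :=
  ![(v.1, v.2 - 1), v, (v.1 - 1, v.2)] k

/-- The sum of a cochain around a triangle; `c (v, k)` is its value on the `k`-th side of the
black triangle at `v`. -/
def triangleCurl (A : Type*) [AddCommGroup A] :
    ((ℤ × ℤ) × Fin 3 → A) →+ (Triangle → A) where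
  -- Edges are oriented counterclockwise around black triangles, hence clockwise around white ones,
  -- so all signs agree.
  toFun c t := if t.2 then c (t.1, 0) + c (t.1, 1) + c (t.1, 2)
    else c ((t.1.1, t.1.2 + 1), 0) + c (t.1, 1) + c ((t.1.1 + 1, t.1.2), 2)
  map_zero' := by ext; simp
  map_add' c c' := by ext t; dsimp only [Pi.add_apply]; split_ifs <;> abel

/-- Going along the sides of the black triangles changes `φ` as prescribed by `c`. -/
def IsPotentialAt {A : Type*} [AddCommGroup A] (φ : ℤ × ℤ → A) (c : (ℤ × ℤ) × Fin 3 → A)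
    (e : (ℤ × ℤ) × Fin 3) : Prop :=
  φ (triangleCorner (e.1, true) (e.2 + 1)) - φ (triangleCorner (e.1, true) e.2) = c e

/-- Sides 0 and 2 are grid edges; closedness on the black triangle gives the diagonal side 1. -/
theorem isPotentialAt_of_grid {A : Type*} [AddCommGroup A] {φ : ℤ → ℤ → A}
    {c : (ℤ × ℤ) × Fin 3 → A} {v : ℤ × ℤ}
    (hx : φ (v.1 + 1) v.2 - φ v.1 v.2 = c (v, 0)) (hy : φ v.1 (v.2 + 1) - φ v.1 v.2 = -c (v, 2))
    (hc : triangleCurl A c (v, true) = 0) (k : Fin 3) :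
    IsPotentialAt (fun u => φ u.1 u.2) c (v, k) := by
  have h1 : c (v, 1) = -c (v, 0) - c (v, 2) := by
    rw [← sub_eq_zero, ← hc]; simp [triangleCurl]; abel
  fin_cases k
  · simpa [IsPotentialAt, triangleCorner] using hx
  · have e : (1 : Fin 3) + 1 = 2 := rfl
    simp only [IsPotentialAt, triangleCorner, if_true, Fin.mk_one, h1, ← hx, e]
    rw [sub_eq_add_neg _ (c (v, 2)), ← hy]
    simp
  · have e : (2 : Fin 3) + 1 = 0 := rfl
    simp only [IsPotentialAt, triangleCorner, if_true, Fin.reduceFinMk, e]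
    rw [← neg_neg (c (v, 2)), ← hy]
    simp

theorem triangle_exists_potential {R : Finset Triangle}
    (hR : IsSimplyConnected (body triangleCorners trianglePt R)) {A : Type*} [AddCommGroup A]
    (c : (ℤ × ℤ) × Fin 3 → A) (hc : ∀ t ∈ R, triangleCurl A c t = 0) :
    ∃ φ : ℤ × ℤ → A, ∀ v k, ((v, true) ∈ R ∨ (whiteAt v k, false) ∈ R) →
      IsPotentialAt φ c (v, k) := by
  obtain ⟨N, hN⟩ := (R.image Prod.fst).exists_box
  replace hN : ∀ t ∈ R, _ := fun t ht => hN t.1 (Finset.mem_image_of_mem _ ht)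
  -- The margin is needed because a side of a white triangle of `R` is indexed by a black neighbour,
  -- which may lie outside `R`.
  let I : Finset ℤ := Finset.Icc (-N - 1) (N + 1)
  let B : Finset Triangle := (I ×ˢ I) ×ˢ Finset.univ
  obtain ⟨c', hc', hcurl⟩ := exists_closed_extension (triangleCurl A)
    {e | ¬ ((e.1, true) ∈ R ∨ (whiteAt e.1 e.2, false) ∈ R)} (B \ R)
    (by
      intro T hT hne
      by_contra hcon
      refine hne.ne_empty (triangle_eq_empty_of_enclosed hR
        (Finset.disjoint_of_subset_left hT Finset.sdiff_disjoint) fun f hf k => ?_)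
      by_contra hk
      rw [not_or] at hk
      have hfR : f ∉ R := (Finset.mem_sdiff.1 (hT hf)).2
      refine hcon ⟨f, hf, (if f.2 then f.1 else (triangleNeighbour (f, k)).1.1, k),
        ?_, fun a => ⟨a, ?_⟩, fun u hu huf b => ?_⟩
      · obtain ⟨⟨a, b⟩, d⟩ := f
        cases d <;> fin_cases k <;> simpa [triangleNeighbour, whiteAt, hfR] using hk.2
      · obtain ⟨⟨a, b⟩, d⟩ := f
        cases d <;> fin_cases k <;>
          simp [triangleCurl, triangleNeighbour, Prod.ext_iff]
      · have hu' : u ≠ (triangleNeighbour (f, k)).1 := fun h => hk.1 (h ▸ hu)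
        obtain ⟨⟨f1, f2⟩, d⟩ := f
        obtain ⟨⟨u1, u2⟩, d'⟩ := u
        simp only [ne_eq, Prod.mk.injEq] at huf
        cases d <;> cases d' <;> fin_cases k <;> simp [triangleNeighbour] at hu' huf <;>
          simp [triangleCurl, triangleNeighbour, Pi.single_apply, Prod.ext_iff] <;> grind) c
  have hB : ∀ t ∈ B, triangleCurl A c' t = 0 := by
    intro t ht
    by_cases htR : t ∈ R
    · rw [← hc t htR]
      obtain ⟨⟨a, b⟩, d⟩ := t
      have hcR : ∀ v k, ((v, true) ∈ R ∨ (whiteAt v k, false) ∈ R) → c' (v, k) = c (v, k) :=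
        fun v k h => hc' (v, k) (not_not.2 h)
      cases d
      · simp only [triangleCurl, AddMonoidHom.coe_mk, ZeroHom.coe_mk, Bool.false_eq_true, if_false]
        rw [hcR, hcR, hcR] <;> exact Or.inr (by simpa [whiteAt] using htR)
      · simp only [triangleCurl, AddMonoidHom.coe_mk, ZeroHom.coe_mk, if_true]
        rw [hcR, hcR, hcR] <;> exact Or.inl htR
    · exact hcurl t (Finset.mem_sdiff.2 ⟨ht, htR⟩)
  have hBmem : ∀ x y d, -N - 1 ≤ x → x ≤ N + 1 → -N - 1 ≤ y → y ≤ N + 1 → ((x, y), d) ∈ B := by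
    intro x y d h1 h2 h3 h4
    simp only [B, I, Finset.mem_product, Finset.mem_Icc, Finset.mem_univ, and_true]
    omega
  obtain ⟨φ, hy, hx⟩ := exists_grid_potential (fun x y => c' ((x, y), 0))
    (fun x y => -c' ((x, y), 2)) (-N - 1)
  refine ⟨fun v => φ v.1 v.2, fun v k hvk => ?_⟩
  have hv : -N ≤ v.1 ∧ v.1 ≤ N + 1 ∧ -N ≤ v.2 ∧ v.2 ≤ N + 1 := by
    rcases hvk with h | h
    · have := hN _ h
      dsimp only at this
      omega
    · have := hN _ h
      fin_cases k <;> simp [whiteAt] at this <;> omega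
  have := isPotentialAt_of_grid (φ := φ) (c := c') (v := v) (hx _ _ fun t ht1 ht2 => ?_) (hy _ _)
    (hB _ (hBmem _ _ _ (by omega) (by omega) (by omega) (by omega))) k
  · rw [IsPotentialAt] at this ⊢
    rw [this]
    exact hc' (v, k) (not_not.2 hvk)
  · have h1 := hB _ (hBmem v.1 t true (by omega) (by omega) (by omega) (by omega))
    have h2 := hB _ (hBmem v.1 t false (by omega) (by omega) (by omega) (by omega))
    simp only [triangleCurl, AddMonoidHom.coe_mk, ZeroHom.coe_mk, Bool.false_eq_true, if_false,
      if_true] at h1 h2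
    rw [← sub_eq_zero_of_eq (h1.trans h2.symm)]
    abel

/-- A cochain closed on all triangles that vanishes on all edges not interior to a simply connected
region has a potential that vanishes at all vertices not interior to the region. -/
theorem triangle_exists_interior_potential {R : Finset Triangle}
    (hR : IsSimplyConnected (body triangleCorners trianglePt R)) {A : Type*} [AddCommGroup A]
    (c : (ℤ × ℤ) × Fin 3 → A) (hc : ∀ t, triangleCurl A c t = 0)
    (hcR : ∀ v k, ¬ ((v, true) ∈ R ∧ (whiteAt v k, false) ∈ R) → c (v, k) = 0) :
    ∃ φ : ℤ × ℤ → A, (∀ e, IsPotentialAt φ c e) ∧ ∀ t ∉ R, ∀ k, φ (triangleCorner t k) = 0 := by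
  classical
  obtain ⟨N, hN⟩ := (R.image Prod.fst).exists_box
  replace hN : ∀ t ∈ R, _ := fun t ht => hN t.1 (Finset.mem_image_of_mem _ ht)
  obtain ⟨φ, hy, hx⟩ := exists_grid_potential (fun x y => c ((x, y), 0))
    (fun x y => -c ((x, y), 2)) 0
  replace hx : ∀ x y, φ (x + 1) y - φ x y = c ((x, y), 0) := fun x y => hx x y fun t _ _ => by
    have h1 := hc ((x, t), true)
    have h2 := hc ((x, t), false)
    simp only [triangleCurl, AddMonoidHom.coe_mk, ZeroHom.coe_mk, Bool.false_eq_true, if_false,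
      if_true] at h1 h2
    rw [← sub_eq_zero_of_eq (h1.trans h2.symm)]
    abel
  have hout : ∀ x y k, ¬ (-N ≤ x ∧ x ≤ N ∧ -N ≤ y ∧ y ≤ N) → c ((x, y), k) = 0 :=
    fun x y k h => hcR _ _ fun h' => h (hN _ h'.1)
  have hrow : ∀ y, ¬ (-N ≤ y ∧ y ≤ N) → ∀ x, φ x y = φ 0 y := by
    intro y hyN x
    have hs : ∀ x, φ (x + 1) y = φ x y := fun x => by
      rw [← sub_eq_zero, hx, hout _ _ _ (by omega)]
    induction x using Int.induction_on with
    | zero => rfl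
    | succ i ih => rw [hs, ih]
    | pred i ih => rw [← ih, ← hs, sub_add_cancel]
  have hcol : ∀ x, ¬ (-N ≤ x ∧ x ≤ N) → ∀ y, φ x y = φ x (N + 1) := by
    intro x hxN y
    have hs : ∀ y, φ x (y + 1) = φ x y := fun y => by
      rw [← sub_eq_zero, hy, hout _ _ _ (by omega), neg_zero]
    have h0 : ∀ y, φ x y = φ x 0 := by
      intro y
      induction y using Int.induction_on with
      | zero => rfl
      | succ i ih => rw [hs, ih]
      | pred i ih => rw [← ih, ← hs, sub_add_cancel]
    rw [h0, h0 (N + 1)]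
  have hconst : ∀ x y, ¬ (-N ≤ x ∧ x ≤ N ∧ -N ≤ y ∧ y ≤ N) → φ x y = φ 0 (N + 1) := by
    intro x y h
    by_cases hxN : -N ≤ x ∧ x ≤ N
    · have hyN : ¬ (-N ≤ y ∧ y ≤ N) := by omega
      rw [hrow y hyN, ← hrow y hyN (N + 1), hcol _ (by omega), hrow _ (by omega)]
    · rw [hcol _ hxN, hrow _ (by omega)]
  -- Normalised to vanish outside the box, where the potential is constant.
  let ψ : ℤ × ℤ → A := fun v => φ v.1 v.2 - φ 0 (N + 1)
  have hψ : ∀ e, IsPotentialAt ψ c e := by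
    rintro ⟨v, k⟩
    have := isPotentialAt_of_grid (φ := φ) (hx v.1 v.2) (hy v.1 v.2) (hc (v, true)) k
    simpa [IsPotentialAt, ψ] using this
  refine ⟨ψ, hψ, ?_⟩
  have hside : ∀ t ∉ R, ∀ k, ψ (triangleCorner t (k + 1)) = ψ (triangleCorner t k) := by
    rintro ⟨⟨a, b⟩, d⟩ ht k
    cases d
    · have h0 := hψ ((a, b + 1), 0)
      have h1 := hψ ((a, b), 1)
      have h2 := hψ ((a + 1, b), 2)
      rw [IsPotentialAt, hcR _ _ (fun h => ht (by simpa [whiteAt] using h.2)), sub_eq_zero] at h0 h1 h2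
      fin_cases k
      · simpa [triangleCorner] using h0.symm
      · simpa [triangleCorner] using h1.symm
      · simpa [triangleCorner] using h2.symm
    · have := hψ ((a, b), k)
      rwa [IsPotentialAt, hcR _ _ (fun h => ht h.1), sub_eq_zero] at this
  have hface : ∀ t ∉ R, ∀ k, ψ (triangleCorner t k) = ψ (triangleCorner t 0) := by
    intro t ht k
    have h0 := hside t ht 0
    have h1 := hside t ht 1
    fin_cases k
    · rfl
    · exact h0
    · exact h1.trans h0
  let I : Finset ℤ := Finset.Icc (-N - 1) N
  -- On the corners of a face outside `R` the potential is constant, and adjacent such faces share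
  -- its value. So the faces where it is nonzero form an enclosed set.
  let U : Finset Triangle := ((I ×ˢ I) ×ˢ Finset.univ).filter
    fun t => t ∉ R ∧ ψ (triangleCorner t 0) ≠ 0
  have hUmem : ∀ t, t ∉ R → ψ (triangleCorner t 0) ≠ 0 → t ∈ U := by
    intro t ht h
    refine Finset.mem_filter.2 ⟨?_, ht, h⟩
    have : -N ≤ (triangleCorner t 0).1 ∧ (triangleCorner t 0).1 ≤ N ∧
        -N ≤ (triangleCorner t 0).2 ∧ (triangleCorner t 0).2 ≤ N := by
      by_contra hcon
      exact h (sub_eq_zero.2 (hconst _ _ hcon))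
    obtain ⟨⟨a, b⟩, d⟩ := t
    cases d <;> simp [triangleCorner] at this <;> simp [I] <;> omega
  have hU : U = ∅ := by
    refine triangle_eq_empty_of_enclosed hR
      (Finset.disjoint_left.2 fun t ht => (Finset.mem_filter.1 ht).2.1) fun t ht k => ?_
    by_contra hk
    rw [not_or] at hk
    obtain ⟨-, htR, h0⟩ := Finset.mem_filter.1 ht
    refine hk.1 (hUmem _ hk.2 ?_)
    rw [← hface _ hk.2 k]
    have e : triangleCorner (triangleNeighbour (t, k)).1 k = triangleCorner t (k + 1) := by
      obtain ⟨⟨a, b⟩, d⟩ := t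
      cases d <;> fin_cases k <;> simp [triangleCorner, triangleNeighbour]
    rw [e, hface _ htR]
    exact h0
  intro t ht k
  rw [hface t ht]
  by_contra h
  exact absurd (hUmem t ht h) (by simp [hU])

/-! ### Kernel vectors of `B` in the quadriculated case -/

theorem squareAdj_iff (f g : Square) : (faceGraph squareCorners).Adj f g ↔
    g ∈ ({(f.1 + 1, f.2), (f.1 - 1, f.2), (f.1, f.2 + 1), (f.1, f.2 - 1)} : Finset Square) := by
  have hV : ∀ f : Square, squareCorners f =
      ({f.1, f.1 + 1} : Finset ℤ) ×ˢ ({f.2, f.2 + 1} : Finset ℤ) := by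
    intro f
    ext v
    simp only [squareCorners, Finset.mem_insert, Finset.mem_singleton, Finset.mem_product,
      Prod.ext_iff]
    tauto
  have hcard : ∀ a b : ℤ, (({a, a + 1} : Finset ℤ) ∩ {b, b + 1}).card =
      if a = b then 2 else if a = b + 1 ∨ b = a + 1 then 1 else 0 := by
    intro a b
    by_cases h : a = b
    · subst h; simp
    by_cases h1 : a = b + 1
    · subst h1
      rw [if_neg h, if_pos (Or.inl rfl), Finset.card_eq_one]
      refine ⟨b + 1, ?_⟩
      ext x; simp; omega
    by_cases h2 : b = a + 1
    · subst h2
      rw [if_neg h, if_pos (Or.inr rfl), Finset.card_eq_one]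
      refine ⟨a + 1, ?_⟩
      ext x; simp; omega
    · rw [if_neg h, if_neg (by tauto), Finset.card_eq_zero]
      ext x; simp; omega
  obtain ⟨a, b⟩ := f
  obtain ⟨c, d⟩ := g
  simp only [faceGraph, hV, Finset.product_inter_product, Finset.card_product, hcard,
    Finset.mem_insert, Finset.mem_singleton, ne_eq, Prod.mk.injEq]
  split_ifs <;> simp <;> omega

/-- A vector indexed by the white faces, as a function of all faces. -/
noncomputable def Labelling.extend {F : Type} [DecidableEq F] {black : F → Prop} {R : Finset F}
    {n : ℕ} (ℓ : Labelling black R n) {A : Type*} [Zero A] (g : Fin n → A) (f : F) : A :=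
  if h : f ∈ R then Sum.elim 0 g (ℓ.face.symm ⟨f, h⟩) else 0

section
variable {F : Type} {black : F → Prop} {R : Finset F} {n : ℕ}
  (ℓ : Labelling black R n) (V : F → Finset (ℤ × ℤ))

theorem Labelling.extend_inr [DecidableEq F] {A : Type*} [Zero A] (g : Fin n → A) (j : Fin n) :
    ℓ.extend g (ℓ.face (Sum.inr j)) = g j := by
  simp [Labelling.extend]

theorem Labelling.extend_of_notMem [DecidableEq F] {A : Type*} [Zero A] (g : Fin n → A) {f : F} (hf : f ∉ R) :
    ℓ.extend g f = 0 := dif_neg hf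

theorem Labelling.exists_inr {f : F} (hf : f ∈ R) (hb : ¬ black f) :
    ∃ j, (ℓ.face (Sum.inr j)).1 = f := by
  obtain ⟨x, hx⟩ := ℓ.face.surjective ⟨f, hf⟩
  rcases x with i | j
  · exact absurd (ℓ.black_inl i) (by rw [hx]; exact hb)
  · exact ⟨j, congrArg Subtype.val hx⟩

theorem Labelling.exists_inl {f : F} (hf : f ∈ R) (hb : black f) :
    ∃ i, (ℓ.face (Sum.inl i)).1 = f := by
  obtain ⟨x, hx⟩ := ℓ.face.surjective ⟨f, hf⟩
  rcases x with i | j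
  · exact ⟨i, congrArg Subtype.val hx⟩
  · exact absurd hb (by have := ℓ.white_inr j; rwa [hx] at this)

theorem Labelling.B_apply [DecidableEq F] (i j : Fin n) : ℓ.B V i j =
    if (faceGraph V).Adj (ℓ.face (Sum.inl i)).1 (ℓ.face (Sum.inr j)).1 then 1 else 0 := by
  simp only [Labelling.B, Labelling.A, Matrix.toBlocks₁₂, Matrix.of_apply, Matrix.submatrix_apply,
    SimpleGraph.adjMatrix_apply]
  rfl

theorem Labelling.mulVec_B [DecidableEq F] {A : Type*} [CommRing A] (g : Fin n → A) (i : Fin n) (S : Finset F)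
    (hS : ∀ f, (faceGraph V).Adj (ℓ.face (Sum.inl i)).1 f ↔ f ∈ S) :
    ((ℓ.B V).map (Int.castRingHom A)).mulVec g i = ∑ f ∈ S, ℓ.extend g f := by
  have h1 : ((ℓ.B V).map (Int.castRingHom A)).mulVec g i =
      ∑ x : Fin n ⊕ Fin n, if (ℓ.face x).1 ∈ S then ℓ.extend g (ℓ.face x) else 0 := by
    rw [Fintype.sum_sum_type, Finset.sum_eq_zero, zero_add]
    · simp only [Matrix.mulVec, dotProduct, Matrix.map_apply, ℓ.B_apply, hS, ℓ.extend_inr]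
      refine Finset.sum_congr rfl fun j _ => ?_
      split_ifs <;> simp
    · intro j _
      simp [Labelling.extend]
  rw [h1, Equiv.sum_comp ℓ.face (fun x => if x.1 ∈ S then ℓ.extend g x.1 else 0),
    Finset.sum_coe_sort R (fun x => if x ∈ S then ℓ.extend g x else 0), Finset.sum_ite_mem]
  refine Finset.sum_subset Finset.inter_subset_right fun f hf hfR => ℓ.extend_of_notMem g ?_
  exact fun h => hfR (Finset.mem_inter.2 ⟨h, hf⟩)

end

theorem Labelling.square_mulVec_B {R : Finset Square} {n : ℕ} (ℓ : Labelling squareBlack R n)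
    {A : Type*} [CommRing A] (g : Fin n → A) (i : Fin n) {a b : ℤ}
    (hab : (ℓ.face (Sum.inl i)).1 = (a, b)) :
    ((ℓ.B squareCorners).map (Int.castRingHom A)).mulVec g i =
      ℓ.extend g (a + 1, b) + ℓ.extend g (a - 1, b) + ℓ.extend g (a, b + 1) +
        ℓ.extend g (a, b - 1) := by
  rw [ℓ.mulVec_B squareCorners g i _ (fun f => by rw [squareAdj_iff, hab])]
  rw [Finset.sum_insert, Finset.sum_insert, Finset.sum_insert, Finset.sum_singleton]
  · ring
  all_goals simp
  all_goals omega

/-- The sign `(-1) ^ y`. -/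
def rowSign (A : Type*) [Ring A] (y : ℤ) : A := if Even y then 1 else -1

theorem rowSign_add_one (A : Type*) [Ring A] (y : ℤ) : rowSign A (y + 1) = -rowSign A y := by
  by_cases h : Even y <;> simp [rowSign, h]

theorem rowSign_sub_one (A : Type*) [Ring A] (y : ℤ) : rowSign A (y - 1) = -rowSign A y := by
  rw [← neg_neg (rowSign A (y - 1)), ← rowSign_add_one, sub_add_cancel]

theorem rowSign_mul_self (A : Type*) [Ring A] (y : ℤ) : rowSign A y * rowSign A y = 1 := by
  by_cases h : Even y <;> simp [rowSign, h]

/-- A nonzero kernel vector of `B` over any commutative ring yields one over the integers. -/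
theorem square_det_eq_zero {R : Finset Square}
    (hR : IsSimplyConnected (body squareCorners squarePt R)) {n : ℕ}
    (ℓ : Labelling squareBlack R n) {A : Type*} [CommRing A] {g : Fin n → A} (hg : g ≠ 0)
    (hBg : ((ℓ.B squareCorners).map (Int.castRingHom A)).mulVec g = 0) :
    (ℓ.B squareCorners).det = 0 := by
  classical
  let G : Square → A := fun p => rowSign A p.2 * ℓ.extend g p
  -- Each edge borders exactly one white position and carries its value of `G`, signed so that the
  -- curl vanishes on white squares. On a black square the row signs turn the curl into the kernel
  -- equation, up to sign.
  let c : (ℤ × ℤ) × Fin 2 → A := fun e =>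
    if Even (e.1.1 + e.1.2) then
      -G (if e.2 = 0 then (e.1.1, e.1.2 - 1) else (e.1.1 - 1, e.1.2))
    else G e.1
  have hc : ∀ f ∈ R, squareCurl A c f = 0 := by
    rintro ⟨a, b⟩ hf
    by_cases hb : Even (a + b)
    · obtain ⟨i, hi⟩ := ℓ.exists_inl hf hb
      have h := congrFun hBg i
      rw [ℓ.square_mulVec_B g i hi, Pi.zero_apply] at h
      have e1 : ¬ Even (a + 1 + b) := by rw [add_right_comm, Int.even_add_one]; exact not_not.2 hb
      have e2 : ¬ Even (a + (b + 1)) := by rw [← add_assoc, Int.even_add_one]; exact not_not.2 hb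
      simp only [squareCurl, AddMonoidHom.coe_mk, ZeroHom.coe_mk, c, hb, e1, e2, if_true, if_false,
        G, rowSign_add_one, rowSign_sub_one, one_ne_zero]
      linear_combination rowSign A b * h
    · have e1 : Even (a + 1 + b) := by rw [add_right_comm, Int.even_add_one]; exact hb
      have e2 : Even (a + (b + 1)) := by rw [← add_assoc, Int.even_add_one]; exact hb
      simp only [squareCurl, AddMonoidHom.coe_mk, ZeroHom.coe_mk, c, hb, e1, e2, if_true, if_false,
        one_ne_zero, add_sub_cancel_right]
      ring
  obtain ⟨φ, hφ⟩ := square_exists_potential hR c hc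
  -- Around a white square the potential takes equal values at opposite corners, and `G` is the
  -- difference of the two values.
  have hwhite : ∀ a b, (a, b) ∈ R → ¬ Even (a + b) → φ (a + 1, b) - φ (a, b) = G (a, b) ∧
      φ (a, b + 1) = φ (a + 1, b) ∧ φ (a + 1, b + 1) = φ (a, b) := by
    intro a b hf hb
    obtain ⟨h1, h2, h3, -⟩ := hφ _ hf
    have e2 : Even (a + (b + 1)) := by rw [← add_assoc, Int.even_add_one]; exact hb
    simp only [c, hb, e2, if_true, if_false, add_sub_cancel_right] at h1 h2 h3
    exact ⟨h1, by linear_combination h2 - h1, by linear_combination h3 + h2⟩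
  obtain ⟨j₀, hj₀⟩ := Function.ne_iff.1 hg
  set p₀ := (ℓ.face (Sum.inr j₀)).1 with hp₀
  -- The level through one corner of `p₀` separates the two values of `φ` there, since `g j₀ ≠ 0`;
  -- this keeps the new vector nonzero.
  let ψ : ℤ × ℤ → ℤ := fun v => if φ v = φ (p₀.1 + 1, p₀.2) then 1 else 0
  have hψ : ∀ u v, φ u = φ v → ψ u = ψ v := fun u v h => by simp only [ψ, h]
  let γ : Square → ℤ := fun p => rowSign ℤ p.2 * (ψ (p.1 + 1, p.2) - ψ p)
  let g' : Fin n → ℤ := fun j => γ (ℓ.face (Sum.inr j))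
  have hext : ∀ p, p ∈ R → ¬ Even (p.1 + p.2) → ℓ.extend g' p = γ p := by
    intro p hp hb
    obtain ⟨j, rfl⟩ := ℓ.exists_inr hp hb
    exact ℓ.extend_inr g' j
  -- A neighbour missing from `R` has `G = 0`, so `φ`, and with it `ψ`, agrees at both ends of the
  -- edge. Thus the boundary needs no separate treatment.
  have hshared : ∀ a b u v, ¬ Even (a + b) →
      ((u = (a + 1, b) ∧ v = (a, b)) ∨ (u = (a, b + 1) ∧ v = (a, b)) ∨
        (u = (a + 1, b) ∧ v = (a + 1, b + 1)) ∨ (u = (a, b + 1) ∧ v = (a + 1, b + 1))) →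
      φ u - φ v = G (a, b) → ℓ.extend g' (a, b) = rowSign ℤ b * (ψ u - ψ v) := by
    intro a b u v hb huv h
    by_cases hp : (a, b) ∈ R
    · obtain ⟨-, h2, h3⟩ := hwhite a b hp hb
      rw [hext _ hp hb]
      have h2' := hψ _ _ h2
      have h3' := hψ _ _ h3
      rcases huv with ⟨rfl, rfl⟩ | ⟨rfl, rfl⟩ | ⟨rfl, rfl⟩ | ⟨rfl, rfl⟩ <;> simp [γ, h2', h3']
    · rw [ℓ.extend_of_notMem g' hp]
      simp only [G, ℓ.extend_of_notMem g hp, mul_zero] at h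
      rw [hψ _ _ (sub_eq_zero.1 h), sub_self, mul_zero]
  refine Matrix.exists_mulVec_eq_zero_iff.1 ⟨g', ?_, ?_⟩
  · refine Function.ne_iff.2 ⟨j₀, ?_⟩
    have hb : ¬ Even (p₀.1 + p₀.2) := ℓ.white_inr j₀
    obtain ⟨h1, -, -⟩ := hwhite p₀.1 p₀.2 (ℓ.face (Sum.inr j₀)).2 hb
    have hne : φ p₀ ≠ φ (p₀.1 + 1, p₀.2) := by
      intro h
      apply hj₀
      have e : G p₀ = 0 := by
        rw [← h] at h1
        simpa using h1.symm
      have := congrArg (rowSign A p₀.2 * ·) e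
      simp only [G, ← mul_assoc, rowSign_mul_self, one_mul, mul_zero] at this
      rwa [hp₀, ℓ.extend_inr] at this
    simp only [g', γ, ← hp₀, ψ, hne, if_true, if_false, sub_zero, mul_one, Pi.zero_apply]
    by_cases h : Even p₀.2 <;> simp [rowSign, h]
  · funext i
    obtain ⟨a, b, hi⟩ : ∃ a b, (ℓ.face (Sum.inl i)).1 = (a, b) := ⟨_, _, rfl⟩
    have hf : (a, b) ∈ R := hi ▸ (ℓ.face (Sum.inl i)).2
    have hb : Even (a + b) := by have := ℓ.black_inl i; rwa [hi] at this
    have h := ℓ.square_mulVec_B g' i hi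
    have e1 : ¬ Even (a + 1 + b) := by rw [add_right_comm, Int.even_add_one]; exact not_not.2 hb
    have e2 : ¬ Even (a + (b + 1)) := by rw [← add_assoc, Int.even_add_one]; exact not_not.2 hb
    have e3 : ¬ Even (a - 1 + b) := fun h => e1 (by
      rw [show a + 1 + b = a - 1 + b + 2 by ring]; exact h.add even_two)
    have e4 : ¬ Even (a + (b - 1)) := fun h => e2 (by
      rw [show a + (b + 1) = a + (b - 1) + 2 by ring]; exact h.add even_two)
    obtain ⟨h1, h2, h3, h4⟩ := hφ _ hf
    simp only [c, hb, e1, e2, if_true, if_false, one_ne_zero] at h1 h2 h3 h4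
    rw [hshared (a + 1) b (a + 1, b + 1) (a + 1, b) e1 (by simp) h4,
      hshared (a - 1) b (a, b) (a, b + 1) e3 (by simp) (by linear_combination -h2),
      hshared a (b + 1) (a + 1, b + 1) (a, b + 1) e2 (by simp) h3,
      hshared a (b - 1) (a, b) (a + 1, b) e4 (by simp) (by linear_combination -h1),
      rowSign_add_one, rowSign_sub_one] at h
    have hid : (ℓ.B squareCorners).map (Int.castRingHom ℤ) = ℓ.B squareCorners := by
      ext; simp
    rw [hid] at h
    rw [h, Pi.zero_apply]
    ring

/-- An integer other than `±1` has a prime divisor `q`, hence `B` is singular over the field `ZMod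
q`, which forces `det B = 0`. -/
theorem square_abs_det_le_one {R : Finset Square}
    (hR : IsSimplyConnected (body squareCorners squarePt R)) {n : ℕ}
    (ℓ : Labelling squareBlack R n) : |(ℓ.B squareCorners).det| ≤ 1 := by
  by_contra hcon
  obtain ⟨q, hq, hdvd⟩ := Nat.exists_prime_and_dvd (n := (ℓ.B squareCorners).det.natAbs)
    (fun h => hcon (by rw [Int.abs_eq_natAbs, h]; norm_num))
  have := Fact.mk hq
  have h0 : ((ℓ.B squareCorners).map (Int.castRingHom (ZMod q))).det = 0 := by
    have e := RingHom.map_det (Int.castRingHom (ZMod q)) (ℓ.B squareCorners)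
    rw [RingHom.mapMatrix_apply] at e
    rw [← e, eq_intCast, ZMod.intCast_zmod_eq_zero_iff_dvd]
    exact Int.natCast_dvd.2 hdvd
  obtain ⟨g, hg, hBg⟩ := Matrix.exists_mulVec_eq_zero_iff.2 h0
  rw [square_det_eq_zero hR ℓ hg hBg] at hcon
  simp at hcon

/-! ### Tilings as permutations, and `det B` as a signed count -/

theorem Labelling.face_inl_ne_inr {F : Type} {black : F → Prop} {R : Finset F} {n : ℕ}
    (ℓ : Labelling black R n) (i j : Fin n) :
    (ℓ.face (Sum.inl i)).1 ≠ (ℓ.face (Sum.inr j)).1 := fun h =>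
  ℓ.white_inr j (h ▸ ℓ.black_inl i)

section
variable {F : Type} [DecidableEq F] {black : F → Prop} {R : Finset F} {n : ℕ}
  (V : F → Finset (ℤ × ℤ)) (ℓ : Labelling black R n)

/-- The permutations whose monomials in the expansion of `det B` do not vanish. -/
def Labelling.IsMatching (σ : Equiv.Perm (Fin n)) : Prop :=
  ∀ i, (faceGraph V).Adj (ℓ.face (Sum.inl i)).1 (ℓ.face (Sum.inr (σ i))).1

instance : DecidablePred (ℓ.IsMatching V) := fun _ => inferInstanceAs (Decidable (∀ _, _))

theorem Labelling.det_B :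
    (ℓ.B V).det = ∑ σ : Equiv.Perm (Fin n) with ℓ.IsMatching V σ, (Equiv.Perm.sign σ : ℤ) := by
  rw [← Matrix.det_transpose, Matrix.det_apply', Finset.sum_filter]
  refine Finset.sum_congr rfl fun σ _ => ?_
  simp only [Matrix.transpose_apply, ℓ.B_apply, Finset.prod_boole, Finset.mem_univ, true_imp_iff]
  split_ifs with h1 h2 h2
  · simp
  · exact absurd h1 h2
  · exact absurd h2 h1
  · rw [mul_zero]

/-- The tile made of the `i`-th black and the `j`-th white face. -/
def Labelling.pair (i j : Fin n) : Finset F :=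
  {(ℓ.face (Sum.inl i)).1, (ℓ.face (Sum.inr j)).1}

theorem Labelling.inl_mem_pair {i i' j : Fin n} :
    (ℓ.face (Sum.inl i)).1 ∈ ℓ.pair i' j ↔ i = i' := by
  simp [Labelling.pair, ℓ.face_inl_ne_inr]

theorem Labelling.inr_mem_pair {i j j' : Fin n} :
    (ℓ.face (Sum.inr j)).1 ∈ ℓ.pair i j' ↔ j = j' := by
  simp [Labelling.pair, (ℓ.face_inl_ne_inr _ _).symm]

/-- The relation between a tiling and its permutation. -/
def Labelling.Describes (T : Tiling V R) (σ : Equiv.Perm (Fin n)) : Prop :=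
  ∀ i, ℓ.pair i (σ i) ∈ T.1.parts

variable {V}

theorem Labelling.Describes.unique_perm {T : Tiling V R} {σ τ : Equiv.Perm (Fin n)}
    (hσ : ℓ.Describes V T σ) (hτ : ℓ.Describes V T τ) : σ = τ := by
  ext1 i
  have h := T.1.eq_of_mem_parts (hσ i) (hτ i) (ℓ.inl_mem_pair.2 rfl) (ℓ.inl_mem_pair.2 rfl)
  exact ℓ.inr_mem_pair.1 (h ▸ ℓ.inr_mem_pair.2 rfl : (ℓ.face (Sum.inr (σ i))).1 ∈ ℓ.pair i (τ i))

theorem Labelling.Describes.subset {T T' : Tiling V R} {σ : Equiv.Perm (Fin n)}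
    (hT : ℓ.Describes V T σ) (hT' : ℓ.Describes V T' σ) : T.1.parts ⊆ T'.1.parts := by
  intro t ht
  obtain ⟨f, hf⟩ := T.1.nonempty_of_mem_parts ht
  obtain ⟨x, hx⟩ := ℓ.face.surjective ⟨f, T.1.le ht hf⟩
  have hx' : (ℓ.face x).1 = f := congrArg Subtype.val hx
  have key : ∀ i, f ∈ ℓ.pair i (σ i) → t ∈ T'.1.parts := fun i hi => by
    rw [T.1.eq_of_mem_parts ht (hT i) hf hi]
    exact hT' i
  rcases x with i | j
  · exact key i (hx' ▸ ℓ.inl_mem_pair.2 rfl)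
  · exact key (σ.symm j) (hx' ▸ ℓ.inr_mem_pair.2 (by simp))

theorem Labelling.Describes.unique_tiling {T T' : Tiling V R} {σ : Equiv.Perm (Fin n)}
    (hT : ℓ.Describes V T σ) (hT' : ℓ.Describes V T' σ) : T = T' :=
  Subtype.ext (Finpartition.ext ((hT.subset ℓ hT').antisymm (hT'.subset ℓ hT)))

theorem Labelling.Describes.isMatching {T : Tiling V R} {σ : Equiv.Perm (Fin n)}
    (hT : ℓ.Describes V T σ) : ℓ.IsMatching V σ := by
  intro i
  obtain ⟨f, g, hfg, h⟩ := T.2 _ (hT i)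
  have h1 : (ℓ.face (Sum.inl i)).1 ∈ ({f, g} : Finset F) := h ▸ ℓ.inl_mem_pair.2 rfl
  have h2 : (ℓ.face (Sum.inr (σ i))).1 ∈ ({f, g} : Finset F) := h ▸ ℓ.inr_mem_pair.2 rfl
  have h3 := ℓ.face_inl_ne_inr i (σ i)
  rw [Finset.mem_insert, Finset.mem_singleton] at h1 h2
  rcases h1 with h1 | h1 <;> rcases h2 with h2 | h2
  · exact absurd (h1.trans h2.symm) h3
  · rwa [h1, h2]
  · rw [h1, h2]; exact hfg.symm
  · exact absurd (h1.trans h2.symm) h3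

theorem Labelling.IsMatching.exists_describes {σ : Equiv.Perm (Fin n)} (hσ : ℓ.IsMatching V σ) :
    ∃ T : Tiling V R, ℓ.Describes V T σ := by
  let P : Finpartition R :=
    { parts := Finset.univ.image fun i => ℓ.pair i (σ i)
      supIndep := by
        rw [Finset.supIndep_iff_pairwiseDisjoint]
        intro s hs t ht hst
        simp only [Finset.coe_image, Finset.coe_univ, Set.image_univ, Set.mem_range] at hs ht
        obtain ⟨i, rfl⟩ := hs
        obtain ⟨j, rfl⟩ := ht
        have hij : i ≠ j := fun h => hst (h ▸ rfl)
        refine Finset.disjoint_left.2 fun f hf hf' => hij ?_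
        rw [id, Labelling.pair, Finset.mem_insert, Finset.mem_singleton] at hf
        rcases hf with rfl | rfl
        · exact ℓ.inl_mem_pair.1 hf'
        · exact σ.injective (ℓ.inr_mem_pair.1 hf')
      sup_parts := by
        ext f
        simp only [Finset.sup_image, Function.id_comp, Finset.mem_sup, Finset.mem_univ, true_and]
        constructor
        · rintro ⟨i, hi⟩
          rw [Labelling.pair, Finset.mem_insert, Finset.mem_singleton] at hi
          rcases hi with rfl | rfl <;> exact Subtype.property _
        · intro hf
          obtain ⟨x, hx⟩ := ℓ.face.surjective ⟨f, hf⟩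
          have hx' : (ℓ.face x).1 = f := congrArg Subtype.val hx
          rcases x with i | j
          · exact ⟨i, hx' ▸ ℓ.inl_mem_pair.2 rfl⟩
          · exact ⟨σ.symm j, hx' ▸ ℓ.inr_mem_pair.2 (by simp)⟩
      bot_notMem := by
        simp [Labelling.pair] }
  refine ⟨⟨P, fun t ht => ?_⟩, fun i => Finset.mem_image_of_mem _ (Finset.mem_univ i)⟩
  obtain ⟨i, -, rfl⟩ := Finset.mem_image.1 ht
  exact ⟨_, _, hσ i, rfl⟩

/-- The tile containing a black face has a white partner, and disjointness of the tiles makes the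
partner map injective. -/
theorem Labelling.exists_describes
    (hV : ∀ f g, (faceGraph V).Adj f g → (black f ↔ ¬ black g)) (T : Tiling V R) :
    ∃ σ, ℓ.Describes V T σ := by
  have h1 : ∀ i, ∃ j, ℓ.pair i j ∈ T.1.parts := by
    intro i
    have hi := T.1.mem_part (ℓ.face (Sum.inl i)).2
    have hp := T.1.part_mem.2 (ℓ.face (Sum.inl i)).2
    have key : ∀ g, (faceGraph V).Adj (ℓ.face (Sum.inl i)).1 g →
        {(ℓ.face (Sum.inl i)).1, g} ∈ T.1.parts → ∃ j, ℓ.pair i j ∈ T.1.parts := by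
      intro g hg ht
      obtain ⟨j, rfl⟩ := ℓ.exists_inr (T.1.le ht (by simp)) ((hV _ _ hg).1 (ℓ.black_inl i))
      exact ⟨j, ht⟩
    obtain ⟨f, g, hfg, h⟩ := T.2 _ hp
    rw [h] at hi hp
    rw [Finset.mem_insert, Finset.mem_singleton] at hi
    rcases hi with hi | hi
    · exact key g (hi ▸ hfg) (hi ▸ hp)
    · exact key f (hi ▸ hfg.symm) (by rw [hi, Finset.pair_comm]; exact hp)
  choose s hs using h1
  have hinj : Function.Injective s := by
    intro i j hij
    have := T.1.eq_of_mem_parts (hs i) (hs j) (ℓ.inr_mem_pair.2 rfl) (ℓ.inr_mem_pair.2 hij)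
    exact ℓ.inl_mem_pair.1 (this ▸ ℓ.inl_mem_pair.2 rfl : (ℓ.face (Sum.inl i)).1 ∈ ℓ.pair j (s j))
  exact ⟨Equiv.ofBijective s (Finite.injective_iff_bijective.1 hinj), hs⟩

theorem Labelling.exists_tiling_equiv
    (hV : ∀ f g, (faceGraph V).Adj f g → (black f ↔ ¬ black g)) :
    ∃ e : Tiling V R ≃ {σ // ℓ.IsMatching V σ}, ∀ T, ℓ.Describes V T (e T).1 := by
  choose s hs using ℓ.exists_describes (V := V) (R := R) hV
  refine ⟨Equiv.ofBijective (fun T => ⟨s T, (hs T).isMatching ℓ⟩) ⟨fun T T' h => ?_, ?_⟩, hs⟩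
  · have h' : s T = s T' := congrArg Subtype.val h
    exact (hs T).unique_tiling ℓ (h' ▸ hs T')
  · rintro ⟨σ, hσ⟩
    obtain ⟨T, hT⟩ := hσ.exists_describes ℓ
    exact ⟨T, Subtype.ext ((hs T).unique_perm ℓ hT)⟩

theorem Labelling.natCard_tiling
    (hV : ∀ f g, (faceGraph V).Adj f g → (black f ↔ ¬ black g)) :
    Nat.card (Tiling V R) = (Finset.univ.filter (ℓ.IsMatching V)).card := by
  obtain ⟨e, -⟩ := ℓ.exists_tiling_equiv hV
  rw [Nat.card_congr e, Nat.card_eq_fintype_card, Fintype.card_subtype]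

theorem Labelling.ncard_signClass
    (hV : ∀ f g, (faceGraph V).Adj f g → (black f ↔ ¬ black g)) (ε : ℤˣ) :
    (signClass V ℓ ε).ncard =
      (Finset.univ.filter fun σ => ℓ.IsMatching V σ ∧ Equiv.Perm.sign σ = ε).card := by
  obtain ⟨e, he⟩ := ℓ.exists_tiling_equiv hV
  have hinj : Function.Injective fun T : Tiling V R => (e T).1 :=
    Subtype.val_injective.comp e.injective
  rw [← Set.ncard_image_of_injective _ hinj, ← Set.ncard_coe_finset]
  congr 1
  ext σ
  simp only [Set.mem_image, Finset.coe_filter, Finset.mem_univ, true_and, Set.mem_ofPred_eq]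
  constructor
  · rintro ⟨T, ⟨τ, hτ, hT⟩, rfl⟩
    refine ⟨(e T).2, ?_⟩
    rw [← hτ, (he T).unique_perm ℓ hT]
  · rintro ⟨hσ, h⟩
    refine ⟨e.symm ⟨σ, hσ⟩, ⟨σ, h, ?_⟩, by simp⟩
    have := he (e.symm ⟨σ, hσ⟩)
    rwa [Equiv.apply_symm_apply] at this

theorem Labelling.det_B_eq_sub
    (hV : ∀ f g, (faceGraph V).Adj f g → (black f ↔ ¬ black g)) :
    (ℓ.B V).det = ((signClass V ℓ 1).ncard : ℤ) - ((signClass V ℓ (-1)).ncard : ℤ) := by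
  rw [ℓ.det_B, ℓ.ncard_signClass hV, ℓ.ncard_signClass hV, ← Finset.filter_filter,
    ← Finset.filter_filter, Finset.card_filter, Finset.card_filter]
  push_cast
  rw [← Finset.sum_sub_distrib]
  refine Finset.sum_congr rfl fun σ _ => ?_
  rcases Int.units_eq_one_or (Equiv.Perm.sign σ) with h | h <;> rw [h] <;> simp

end

theorem squareAdj_black (f g : Square) (h : (faceGraph squareCorners).Adj f g) :
    squareBlack f ↔ ¬ squareBlack g := by
  rw [squareAdj_iff] at h
  simp only [Finset.mem_insert, Finset.mem_singleton] at h
  simp only [squareBlack, Int.even_iff]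
  rcases h with rfl | rfl | rfl | rfl <;> dsimp only <;> omega

/-- Distinct triangles of the same orientation share at most one corner. -/
theorem triangleAdj_black (f g : Triangle) (h : (faceGraph triangleCorners).Adj f g) :
    triangleBlack f ↔ ¬ triangleBlack g := by
  obtain ⟨hne, hcard⟩ := h
  obtain ⟨p, hp, q, hq, hpq⟩ := Finset.one_lt_card.1 (hcard ▸ one_lt_two)
  obtain ⟨⟨a, b⟩, c⟩ := f
  obtain ⟨⟨x, y⟩, d⟩ := g
  obtain ⟨p1, p2⟩ := p
  obtain ⟨q1, q2⟩ := q
  cases c <;> cases d <;>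
    simp [triangleBlack, triangleCorners] at hne hp hq hpq ⊢ <;> omega

/-! ### Lozenge tilings: crossed sides, heights and flips -/

/-- The white neighbours of a black triangle. -/
theorem exists_whiteAt_of_adj {v u : ℤ × ℤ}
    (h : (faceGraph triangleCorners).Adj (v, true) (u, false)) : ∃ k, u = whiteAt v k := by
  obtain ⟨-, hcard⟩ := h
  obtain ⟨p, hp, q, hq, hpq⟩ := Finset.one_lt_card.1 (hcard ▸ one_lt_two)
  obtain ⟨a, b⟩ := v
  obtain ⟨x, y⟩ := u
  obtain ⟨p1, p2⟩ := p
  obtain ⟨q1, q2⟩ := q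
  simp [triangleCorners] at hp hq hpq
  have : (x = a ∧ y = b - 1) ∨ (x = a ∧ y = b) ∨ (x = a - 1 ∧ y = b) := by omega
  rcases this with ⟨rfl, rfl⟩ | ⟨rfl, rfl⟩ | ⟨rfl, rfl⟩
  exacts [⟨0, rfl⟩, ⟨1, rfl⟩, ⟨2, rfl⟩]

theorem triangleCurl_single (v : ℤ × ℤ) (k : Fin 3) (t : Triangle) :
    triangleCurl ℤ (Pi.single (v, k) 1) t =
      (if t = (v, true) then 1 else 0) + if t = (whiteAt v k, false) then 1 else 0 := by
  obtain ⟨⟨a, b⟩, c⟩ := t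
  obtain ⟨x, y⟩ := v
  cases c <;> fin_cases k <;>
    simp [triangleCurl, whiteAt, Pi.single_apply, Prod.ext_iff] <;> grind

section
variable {R : Finset Triangle} {n : ℕ} (ℓ : Labelling triangleBlack R n)

/-- The position of the `i`-th black triangle. -/
def Labelling.blackPos (i : Fin n) : ℤ × ℤ := (ℓ.face (Sum.inl i)).1.1

/-- The permutation `σ` matches the `i`-th black triangle across its `d i`-th side. -/
def Labelling.HasDirections (σ : Equiv.Perm (Fin n)) (d : Fin n → Fin 3) : Prop :=
  ∀ i, (ℓ.face (Sum.inr (σ i))).1 = (whiteAt (ℓ.blackPos i) (d i), false)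

/-- The number of tiles across an edge. -/
def Labelling.tilesAcross (d : Fin n → Fin 3) : (ℤ × ℤ) × Fin 3 → ℤ :=
  ∑ i, Pi.single (ℓ.blackPos i, d i) 1

theorem Labelling.face_inl_eq (i : Fin n) :
    (ℓ.face (Sum.inl i)).1 = (ℓ.blackPos i, true) :=
  Prod.ext rfl (ℓ.black_inl i)

theorem Labelling.blackPos_injective : Function.Injective ℓ.blackPos := by
  intro i j h
  have : (ℓ.face (Sum.inl i)).1 = (ℓ.face (Sum.inl j)).1 := by
    rw [ℓ.face_inl_eq, ℓ.face_inl_eq, h]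
  exact Sum.inl_injective (ℓ.face.injective (Subtype.ext this))

theorem Labelling.IsMatching.exists_directions {σ : Equiv.Perm (Fin n)}
    (hσ : ℓ.IsMatching triangleCorners σ) : ∃ d, ℓ.HasDirections σ d := by
  have : ∀ i, ∃ k, (ℓ.face (Sum.inr (σ i))).1 = (whiteAt (ℓ.blackPos i) k, false) := by
    intro i
    have h := hσ i
    have hw : (ℓ.face (Sum.inr (σ i))).1 = ((ℓ.face (Sum.inr (σ i))).1.1, false) :=
      Prod.ext rfl (by simpa [triangleBlack] using ℓ.white_inr (σ i))
    rw [ℓ.face_inl_eq, hw] at h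
    obtain ⟨k, hk⟩ := exists_whiteAt_of_adj h
    exact ⟨k, hw.trans (by rw [hk])⟩
  choose d hd using this
  exact ⟨d, hd⟩

theorem Labelling.tilesAcross_apply (d : Fin n → Fin 3) (e : (ℤ × ℤ) × Fin 3) :
    ℓ.tilesAcross d e = ∑ i, if e = (ℓ.blackPos i, d i) then 1 else 0 := by
  simp [Labelling.tilesAcross, Finset.sum_apply, Pi.single_apply]

theorem Labelling.tilesAcross_nonneg (d : Fin n → Fin 3) (e : (ℤ × ℤ) × Fin 3) :
    0 ≤ ℓ.tilesAcross d e := by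
  rw [ℓ.tilesAcross_apply]
  exact Finset.sum_nonneg fun i _ => by split_ifs <;> simp

theorem Labelling.exists_of_tilesAcross_ne_zero {d : Fin n → Fin 3} {e : (ℤ × ℤ) × Fin 3}
    (h : ℓ.tilesAcross d e ≠ 0) : ∃ i, e = (ℓ.blackPos i, d i) := by
  rw [ℓ.tilesAcross_apply] at h
  obtain ⟨i, -, hi⟩ := Finset.exists_ne_zero_of_sum_ne_zero h
  exact ⟨i, by by_contra hcon; simp [hcon] at hi⟩

theorem Labelling.tilesAcross_injective : Function.Injective ℓ.tilesAcross := by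
  intro d d' h
  funext i
  have h1 : ℓ.tilesAcross d' (ℓ.blackPos i, d i) ≠ 0 := by
    rw [← h, ℓ.tilesAcross_apply]
    refine ne_of_gt (Finset.sum_pos' (fun j _ => by split_ifs <;> simp) ⟨i, Finset.mem_univ i, ?_⟩)
    simp
  obtain ⟨j, hj⟩ := ℓ.exists_of_tilesAcross_ne_zero h1
  obtain ⟨h2, h3⟩ := Prod.ext_iff.1 hj
  rw [ℓ.blackPos_injective h2]
  rw [ℓ.blackPos_injective h2] at h3
  exact h3

variable {ℓ}

theorem Labelling.HasDirections.unique {σ τ : Equiv.Perm (Fin n)} {d : Fin n → Fin 3}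
    (hσ : ℓ.HasDirections σ d) (hτ : ℓ.HasDirections τ d) : σ = τ := by
  ext1 i
  exact Sum.inr_injective (ℓ.face.injective (Subtype.ext ((hσ i).trans (hτ i).symm)))

theorem Labelling.HasDirections.mem_of_tilesAcross_ne_zero {σ : Equiv.Perm (Fin n)}
    {d : Fin n → Fin 3} (hσ : ℓ.HasDirections σ d) {v : ℤ × ℤ} {k : Fin 3}
    (h : ℓ.tilesAcross d (v, k) ≠ 0) : (v, true) ∈ R ∧ (whiteAt v k, false) ∈ R := by
  obtain ⟨i, hi⟩ := ℓ.exists_of_tilesAcross_ne_zero h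
  obtain ⟨rfl, rfl⟩ := Prod.mk.inj hi
  exact ⟨ℓ.face_inl_eq i ▸ Subtype.property _, hσ i ▸ Subtype.property _⟩

/-- Each face of `R` belongs to exactly one tile, and that tile crosses exactly one of its sides. -/
theorem Labelling.HasDirections.curl_tilesAcross {σ : Equiv.Perm (Fin n)}
    {d : Fin n → Fin 3} (hσ : ℓ.HasDirections σ d) (t : Triangle) :
    triangleCurl ℤ (ℓ.tilesAcross d) t = if t ∈ R then 1 else 0 := by
  rw [Labelling.tilesAcross, map_sum, Finset.sum_apply]
  simp only [triangleCurl_single, ← ℓ.face_inl_eq, ← hσ _]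
  rw [Finset.sum_add_distrib,
    Equiv.sum_comp σ (fun j => if t = (ℓ.face (Sum.inr j)).1 then (1 : ℤ) else 0),
    ← Fintype.sum_sum_type (fun x => if t = (ℓ.face x).1 then (1 : ℤ) else 0),
    Equiv.sum_comp ℓ.face (fun f => if t = f.1 then (1 : ℤ) else 0),
    Finset.sum_coe_sort R (fun f => if t = f then (1 : ℤ) else 0), Finset.sum_ite_eq]

/-- If the height difference `w` of two tilings is positive somewhere, then the first tiling can
be changed by rotating three lozenges around a vertex so that the height difference decreases. -/
theorem Labelling.HasDirections.exists_flip
    (hR : IsSimplyConnected (body triangleCorners trianglePt R))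
    {σ : Equiv.Perm (Fin n)} {d d' : Fin n → Fin 3} (hσ : ℓ.HasDirections σ d)
    {w : ℤ × ℤ → ℤ} (hw : ∀ e, IsPotentialAt w (ℓ.tilesAcross d' - ℓ.tilesAcross d) e)
    (hw0 : ∀ t ∉ R, ∀ k, w (triangleCorner t k) = 0) {v₀ : ℤ × ℤ} (hv₀ : 0 < w v₀) :
    ∃ (σ₁ : Equiv.Perm (Fin n)) (d₁ : Fin n → Fin 3) (w₁ : ℤ × ℤ → ℤ),
      ℓ.HasDirections σ₁ d₁ ∧ Equiv.Perm.sign σ₁ = Equiv.Perm.sign σ ∧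
      (∀ e, IsPotentialAt w₁ (ℓ.tilesAcross d' - ℓ.tilesAcross d₁) e) ∧
      (∀ t ∉ R, ∀ k, w₁ (triangleCorner t k) = 0) ∧
      ∑ v ∈ R.image Prod.fst, (w₁ v).natAbs < ∑ v ∈ R.image Prod.fst, (w v).natAbs := by
  -- The height function: along an oriented side it rises by 1, or falls by 2 if a tile crosses the
  -- side. It closes up because one of the three sides of each face is crossed.
  obtain ⟨h, hh⟩ := triangle_exists_potential hR (fun e => 1 - 3 * ℓ.tilesAcross d e) (by
    intro t ht
    have h1 := hσ.curl_tilesAcross t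
    rw [if_pos ht] at h1
    obtain ⟨⟨a, b⟩, c⟩ := t
    cases c <;> simp [triangleCurl] at h1 ⊢ <;> linarith)
  have hmem : ∀ v, 0 < w v → ∀ t k, triangleCorner t k = v → t ∈ R := by
    intro v hv t k htk
    by_contra ht
    have := hw0 t ht k
    rw [htk] at this
    omega
  have hI : ∀ v, 0 < w v → v ∈ R.image Prod.fst := fun v hv =>
    Finset.mem_image.2 ⟨(v, true), hmem v hv _ 0 (by simp [triangleCorner]), rfl⟩
  obtain ⟨u, hu, humax⟩ := (R.image Prod.fst).exists_max_image w ⟨v₀, hI v₀ hv₀⟩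
  have hu0 : 0 < w u := hv₀.trans_le (humax v₀ (hI v₀ hv₀))
  replace humax : ∀ v, w v ≤ w u := fun v => by
    rcases le_or_gt (w v) 0 with hv | hv
    · omega
    · exact humax v (hI v hv)
  obtain ⟨v, hv, hvmax⟩ := ((R.image Prod.fst).filter fun v => w v = w u).exists_max_image h
    ⟨u, Finset.mem_filter.2 ⟨hu, rfl⟩⟩
  have hwv : w v = w u := (Finset.mem_filter.1 hv).2
  have hv0 : 0 < w v := hwv ▸ hu0
  -- Along an uncrossed side leaving `v`, `w` cannot decrease and `h` grows by 1, against the choice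
  -- of `v` as highest among the maxima of `w`. So all three outgoing sides are crossed, and their
  -- lozenges fill the hexagon around `v`.
  have hout : ∀ x k, triangleCorner (x, true) k = v → ∃ i, (x, k) = (ℓ.blackPos i, d i) := by
    intro x k hx
    by_contra hcon
    have hz : ℓ.tilesAcross d (x, k) = 0 := by
      by_contra hz
      exact hcon (ℓ.exists_of_tilesAcross_ne_zero hz)
    have h1 := hw (x, k)
    have h2 := hh x k (Or.inl (hmem v hv0 _ k hx))
    simp only [IsPotentialAt, Pi.sub_apply, hz, hx] at h1 h2
    have h3 := ℓ.tilesAcross_nonneg d' (x, k)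
    have h4 := humax (triangleCorner (x, true) (k + 1))
    have h5 := hvmax (triangleCorner (x, true) (k + 1))
      (Finset.mem_filter.2 ⟨hI _ (by omega), by omega⟩)
    omega
  obtain ⟨i₁, h₁⟩ := hout v 0 (by simp [triangleCorner])
  obtain ⟨i₂, h₂⟩ := hout (v.1 - 1, v.2) 1 (by simp [triangleCorner])
  obtain ⟨i₃, h₃⟩ := hout (v.1, v.2 - 1) 2 (by simp [triangleCorner])
  obtain ⟨hb₁, hd₁⟩ := Prod.mk.inj h₁
  obtain ⟨hb₂, hd₂⟩ := Prod.mk.inj h₂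
  obtain ⟨hb₃, hd₃⟩ := Prod.mk.inj h₃
  have h12 : i₁ ≠ i₂ := by rintro rfl; rw [← hd₁] at hd₂; exact absurd hd₂ (by decide)
  have h13 : i₁ ≠ i₃ := by rintro rfl; rw [← hd₁] at hd₃; exact absurd hd₃ (by decide)
  have h23 : i₂ ≠ i₃ := by rintro rfl; rw [← hd₂] at hd₃; exact absurd hd₃ (by decide)
  -- After the rotation the tiles cross the three sides entering `v`.
  let d₁ : Fin n → Fin 3 := fun i => if i = i₁ then 2 else if i = i₂ then 0 else
    if i = i₃ then 1 else d i
  have e1 : d₁ i₁ = 2 := if_pos rfl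
  have e2 : d₁ i₂ = 0 := by simp [d₁, h12.symm]
  have e3 : d₁ i₃ = 1 := by simp [d₁, h13.symm, h23.symm]
  have e4 : ∀ i, i ≠ i₁ → i ≠ i₂ → i ≠ i₃ → d₁ i = d i := fun i a b c => by simp [d₁, a, b, c]
  have hacross : ∀ e, ℓ.tilesAcross d₁ e - ℓ.tilesAcross d e =
      (Pi.single v 1 : ℤ × ℤ → ℤ) (triangleCorner (e.1, true) (e.2 + 1)) -
        (Pi.single v 1 : ℤ × ℤ → ℤ) (triangleCorner (e.1, true) e.2) := by
    intro e
    rw [ℓ.tilesAcross_apply, ℓ.tilesAcross_apply, ← Finset.sum_sub_distrib,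
      ← Finset.sum_subset (Finset.subset_univ {i₁, i₂, i₃}), Finset.sum_insert (by simp [h12, h13]),
      Finset.sum_insert (by simp [h23]), Finset.sum_singleton, e1, e2, e3, ← hb₁, ← hb₂, ← hb₃,
      ← hd₁, ← hd₂, ← hd₃]
    · obtain ⟨⟨a, b⟩, k⟩ := e
      obtain ⟨x, y⟩ := v
      fin_cases k <;> simp [triangleCorner, Pi.single_apply, Prod.ext_iff] <;> grind
    · intro i _ hi
      simp only [Finset.mem_insert, Finset.mem_singleton, not_or] at hi
      rw [e4 i hi.1 hi.2.1 hi.2.2, sub_self]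
  refine ⟨σ * (Equiv.swap i₁ i₂ * Equiv.swap i₂ i₃), d₁, w - Pi.single v 1, fun i => ?_, ?_,
    fun e => ?_, fun t ht k => ?_, ?_⟩
  · have hσ₁ := hσ i₁
    have hσ₂ := hσ i₂
    have hσ₃ := hσ i₃
    rw [← hb₁, ← hd₁] at hσ₁
    rw [← hb₂, ← hd₂] at hσ₂
    rw [← hb₃, ← hd₃] at hσ₃
    simp only [Equiv.Perm.mul_apply]
    by_cases a1 : i = i₁
    · rw [a1, Equiv.swap_apply_of_ne_of_ne h12 h13, Equiv.swap_apply_left, hσ₂, e1, ← hb₁]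
      simp [whiteAt]
    by_cases a2 : i = i₂
    · rw [a2, Equiv.swap_apply_left, Equiv.swap_apply_of_ne_of_ne h13.symm h23.symm, hσ₃, e2,
        ← hb₂]
      simp [whiteAt]
    by_cases a3 : i = i₃
    · rw [a3, Equiv.swap_apply_right, Equiv.swap_apply_right, hσ₁, e3, ← hb₃]
      simp [whiteAt]
    · rw [Equiv.swap_apply_of_ne_of_ne a2 a3, Equiv.swap_apply_of_ne_of_ne a1 a2, hσ,
        e4 i a1 a2 a3]
  · rw [map_mul, map_mul, Equiv.Perm.sign_swap h12, Equiv.Perm.sign_swap h23]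
    simp
  · have h1 := hw e
    have h2 := hacross e
    simp only [IsPotentialAt, Pi.sub_apply] at h1 ⊢
    linarith
  · have hne : triangleCorner t k ≠ v := fun e => ht (hmem v hv0 t k e)
    simp [hne, hw0 t ht k]
  · refine Finset.sum_lt_sum (fun x _ => ?_) ⟨v, hI v hv0, ?_⟩
    · by_cases hx : x = v
      · subst hx; simp; omega
      · simp [hx]
    · simp; omega

/-- Induction on the sum of `|w|`: where `w` is positive the first tiling is flipped, where it is
negative the second. If `w = 0`, the tilings coincide. -/
theorem Labelling.HasDirections.sign_eq
    (hR : IsSimplyConnected (body triangleCorners trianglePt R))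
    {σ τ : Equiv.Perm (Fin n)} {d d' : Fin n → Fin 3} (hσ : ℓ.HasDirections σ d)
    (hτ : ℓ.HasDirections τ d') : Equiv.Perm.sign σ = Equiv.Perm.sign τ := by
  obtain ⟨w, hw, hw0⟩ := triangle_exists_interior_potential hR
    (ℓ.tilesAcross d' - ℓ.tilesAcross d) (fun t => by
      rw [map_sub, Pi.sub_apply, hσ.curl_tilesAcross, hτ.curl_tilesAcross, sub_self])
    (fun v k hvk => by
      rw [Pi.sub_apply, not_not.1 fun h => hvk (hσ.mem_of_tilesAcross_ne_zero h),
        not_not.1 fun h => hvk (hτ.mem_of_tilesAcross_ne_zero h), sub_self])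
  induction hN : ∑ v ∈ R.image Prod.fst, (w v).natAbs using Nat.strong_induction_on
    generalizing σ τ d d' w with
  | _ N ih =>
    subst hN
    by_cases h0 : ∀ v, w v = 0
    · have : d' = d := ℓ.tilesAcross_injective (by
        funext e
        have := hw e
        simp only [IsPotentialAt, h0, sub_self, Pi.sub_apply] at this
        linarith)
      subst this
      rw [hσ.unique hτ]
    · push Not at h0
      obtain ⟨v, hv⟩ := h0
      rcases lt_or_gt_of_ne hv with hv | hv
      · obtain ⟨τ₁, d₁, w₁, h1, h2, h3, h4, h5⟩ := hτ.exists_flip hR (d' := d) (w := -w)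
          (fun e => by
            have := hw e
            simp only [IsPotentialAt, Pi.sub_apply, Pi.neg_apply] at this ⊢
            linarith)
          (fun t ht k => by simp [hw0 t ht k]) (v₀ := v) (by simpa using hv)
        rw [← h2]
        refine ih _ (by simpa using h5) hσ h1 (-w₁) (fun e => ?_)
          (fun t ht k => by simp [h4 t ht k]) (by simp)
        have := h3 e
        simp only [IsPotentialAt, Pi.sub_apply, Pi.neg_apply] at this ⊢
        linarith
      · obtain ⟨σ₁, d₁, w₁, h1, h2, h3, h4, h5⟩ := hσ.exists_flip hR hw hw0 hv
        rw [← h2]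
        exact ih _ h5 h1 hτ w₁ h3 h4 rfl

end

/-! ### The triangulated case and the conclusion -/

theorem triangle_abs_det {R : Finset Triangle}
    (hR : IsSimplyConnected (body triangleCorners trianglePt R)) {n : ℕ}
    (ℓ : Labelling triangleBlack R n) :
    |(ℓ.B triangleCorners).det| = (Nat.card (Tiling triangleCorners R) : ℤ) ∧
      (signClass triangleCorners ℓ 1 = ∅ ∨ signClass triangleCorners ℓ (-1) = ∅) := by
  have hsign : ∀ σ τ, ℓ.IsMatching triangleCorners σ → ℓ.IsMatching triangleCorners τ →
      Equiv.Perm.sign σ = Equiv.Perm.sign τ := by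
    intro σ τ hσ hτ
    obtain ⟨d, hd⟩ := hσ.exists_directions
    obtain ⟨d', hd'⟩ := hτ.exists_directions
    exact hd.sign_eq hR hd'
  constructor
  · rw [ℓ.det_B, ℓ.natCard_tiling triangleAdj_black]
    by_cases hM : ∃ σ, ℓ.IsMatching triangleCorners σ
    · obtain ⟨σ, hσ⟩ := hM
      rw [Finset.sum_congr rfl fun τ hτ => by
        rw [hsign τ σ (Finset.mem_filter.1 hτ).2 hσ], Finset.sum_const]
      rcases Int.units_eq_one_or (Equiv.Perm.sign σ) with h | h <;> simp [h]
    · rw [Finset.filter_false_of_mem fun σ _ h => hM ⟨σ, h⟩]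
      simp
  · by_contra hcon
    rw [not_or, ← ne_eq, ← ne_eq, ← Set.nonempty_iff_ne_empty, ← Set.nonempty_iff_ne_empty] at hcon
    obtain ⟨⟨T, σ, hσ, hT⟩, T', τ, hτ, hT'⟩ := hcon
    have h1 : ℓ.IsMatching triangleCorners σ := Labelling.Describes.isMatching ℓ (T := T) hT
    have h2 : ℓ.IsMatching triangleCorners τ := Labelling.Describes.isMatching ℓ (T := T') hT'
    have := hsign σ τ h1 h2
    rw [hσ, hτ] at this
    exact absurd this (by decide)

end Tilings

open Tilings in
theorem theorem2p2 :
    (∀ (R : Finset Square), IsSimplyConnected (body squareCorners squarePt R) →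
      ∀ (n : ℕ) (ℓ : Labelling squareBlack R n),
        |(ℓ.B squareCorners).det| ≤ 1 ∧
        |((signClass squareCorners ℓ 1).ncard : ℤ) -
          ((signClass squareCorners ℓ (-1)).ncard : ℤ)| ≤ 1) ∧
    (∀ (R : Finset Triangle), IsSimplyConnected (body triangleCorners trianglePt R) →
      ∀ (n : ℕ) (ℓ : Labelling triangleBlack R n),
        |(ℓ.B triangleCorners).det| = (Nat.card (Tiling triangleCorners R) : ℤ) ∧
        (signClass triangleCorners ℓ 1 = ∅ ∨ signClass triangleCorners ℓ (-1) = ∅)) := by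
  refine ⟨fun R hR n ℓ => ?_, fun R hR n ℓ => triangle_abs_det hR ℓ⟩
  have h := square_abs_det_le_one hR ℓ
  exact ⟨h, by rwa [ℓ.det_B_eq_sub squareAdj_black] at h⟩
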